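/- Let $M,n$ be non-negative integers and consider iid vectors $x_1,\dots,x_n\sim\mathcal N(0,\Sigma)$ in $\mathbb R^M$ with unknown positive definite covariance matrix $\Sigma$, with density $f(x\mid\Sigma)=\big((2\pi)^{M}\det\Sigma\big)^{-1/2}\exp(-\tfrac12x^T\Sigma^{-1}x)$ for one vector and $f(x^n\mid\Sigma)=\prod_{i\le n}f(x_i\mid\Sigma)$ for the sample $x^n=(x_1,\dots,x_n)$. Write $\hat\Sigma_n=\sum_{i\le n}x_ix_i^T$, $\operatorname{etr}(A)=e^{\operatorname{tr}A}$, $d\Sigma=\prod_{i\le j}d\sigma_{ij}$ for Lebesgue measure on symmetric matrices, and $\Gamma_M(a)=\int_{V>0}\det(V)^{a-\frac{M+1}2}\operatorname{etr}(-V)\,dV$. For $\nu>M-1$ and $\Psi>0$, the inverse-Wishart distribution $\mathcal W_M^{-1}(\Psi,\nu)$ has the density $$\frac{\det(\Psi)^{\nu/2}}{2^{\nu M/2}\,\Gamma_M(\nu/2)}\det(\Sigma)^{-\frac{\nu+M+1}{2}}\operatorname{etr}\{-\tfrac12\Psi\Sigma^{-1}\}\qquad(\Sigma>0).$$ (a)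 (Model and sufficient statistic.) For every $\Sigma>0$ the function $f(x^n\mid\Sigma)=\big((2\pi)^{Mn}\det(\Sigma)^n\big)^{-1/2}\operatorname{etr}\{-\tfrac12\hat\Sigma_n\Sigma^{-1}\}$ is the density of the law of the sample, and $\hat\Sigma_n$ is a sufficient statistic for $\Sigma$. (b) (Pivot.) Let $z_1,\dots,z_n$ be iid $\mathcal N(0,I)$ and $U=\sum_{i\le n} z_iz_i^T$. If $SS^T=\Sigma>0$, then $(Sz_1,\dots,Sz_n)$ has the law of the sample, its statistic is $\hat\Sigma_n=SUS^T$, and, whenever $U>0$, with $U^{1/2}$ a positive definite square root of $U$ and $\hat S=SU^{1/2}$ one has $\hat S\hat S^T=\hat\Sigma_n$ and $\Sigma=\hat SU^{-1}\hat S^T$. If $n\ge M$, then $U>0$ almost surely and $U^{-1}\sim\mathcal W_M^{-1}(I,n)$. (c) (Sufficient statistic method.) Let $x^n$ be observed data with $\hat\Sigma_n>0$, and let $\hat S_n$ be any square matrix with $\hat S_n\hat S_n^T=\hat\Sigma_n$. The distribution that the method assigns to $\Sigma$, namely the law of $\hat S_nU^{-1}\hat S_n^T$ for fixed $\hat S_n$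 and random $U$ as in (b), is the probability distribution $\mathcal W_M^{-1}(\hat\Sigma_n,n)$; in particular it does not depend on the choice of $\hat S_n$. With $f_{x^n}$ its density, for every $x_{n+1}\in\mathbb R^M$ the predictive density $f(x_{n+1}\mid x^n)=\int_{\Sigma>0} f(x_{n+1}\mid\Sigma)f_{x^n}(\Sigma)\,d\Sigma$ is a convergent integral and $$f(x_{n+1}\mid x^n)=\frac1{\pi^{M/2}}\,\frac{\det(\hat\Sigma_n)^{n/2}}{\det(\hat\Sigma_{n+1})^{(n+1)/2}}\,\frac{\Gamma_M(\frac{n+1}2)}{\Gamma_M(\frac n2)}.$$ (d) (Normalized likelihood method, NLM.) Let $x^n$ be observed data with $\hat\Sigma_n>0$ and let $n>2M$. Then $C(x^n)=\int_{\Sigma>0}f(x^n\mid\Sigma)\,d\Sigma$ converges, $$C(x^n)=\frac{\Gamma_M\big(\frac n2-\frac{M+1}2\big)}{2^{M(M+1)/2}\,\pi^{Mn/2}\det(\hat\Sigma_n)^{\frac n2-\frac{M+1}2}},$$ $f(x^n\mid\Sigma)/C(x^n)$ is a probability density on $\Sigma>0$, and for every $x_{n+1}\in\mathbb R^M$ the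 predictive density $f(x_{n+1}\mid x^n)=\int_{\Sigma>0} f(x_{n+1}\mid\Sigma)\frac{f(x^n\mid\Sigma)}{C(x^n)}\,d\Sigma$ is a convergent integral and $$f(x_{n+1}\mid x^n)=\frac{C(x^{n+1})}{C(x^n)}=\frac1{\pi^{M/2}}\,\frac{\det(\hat\Sigma_n)^{\frac n2-\frac{M+1}2}}{\det(\hat\Sigma_{n+1})^{\frac n2-\frac M2}}\,\frac{\Gamma_M(\frac n2-\frac M2)}{\Gamma_M(\frac n2-\frac{M+1}2)}.$$ -/

import Mathlib

open MeasureTheory ProbabilityTheory Matrix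

noncomputable section

/-- Measurable structure on real matrices: the product of the Borel structures of the entries. -/
instance matrixMeasurableSpace (M : ℕ) : MeasurableSpace (Matrix (Fin M) (Fin M) ℝ) :=
  inferInstanceAs (MeasurableSpace (Fin M → Fin M → ℝ))

/-- The positions on and above the diagonal of an `M × M` matrix. -/
abbrev UpperIdx (M : ℕ) : Type := {p : Fin M × Fin M // p.1 ≤ p.2}

/-- The symmetric matrix with given entries on and above the diagonal. -/
def symMatrix {M : ℕ} (v : UpperIdx M → ℝ) : Matrix (Fin M) (Fin M) ℝ :=
  Matrix.of fun i j => v ⟨(min i j, max i j), min_le_max⟩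

/-- The measure `dΣ = ∏_{i ≤ j} dσ_{ij}` on symmetric `M × M` matrices, as a measure on all
`M × M` matrices that is carried by the symmetric ones. -/
def symVolume (M : ℕ) : Measure (Matrix (Fin M) (Fin M) ℝ) :=
  (volume : Measure (UpperIdx M → ℝ)).map symMatrix

/-- The domain `Σ > 0` of positive definite symmetric matrices. -/
def posDefSet (M : ℕ) : Set (Matrix (Fin M) (Fin M) ℝ) := {A | A.PosDef}

/-- The exponential of the trace, `etr A = exp (tr A)`. -/
def etr {M : ℕ} (A : Matrix (Fin M) (Fin M) ℝ) : ℝ := Real.exp A.trace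

/-- The multivariate gamma function
`Γ_M(a) = ∫_{V > 0} det(V)^{a - (M+1)/2} etr(-V) dV`. -/
def multiGamma (M : ℕ) (a : ℝ) : ℝ :=
  ∫ V in posDefSet M, V.det ^ (a - ((M : ℝ) + 1) / 2) * etr (-V) ∂(symVolume M)

/-- The density of `N(0, Σ)` at `x ∈ ℝ^M`, for positive definite `Σ`. -/
def gaussDensity {M : ℕ} (A : Matrix (Fin M) (Fin M) ℝ) (x : EuclideanSpace ℝ (Fin M)) : ℝ :=
  1 / Real.sqrt ((2 * Real.pi) ^ M * A.det) *
    Real.exp (-(1 / 2) * (x.ofLp ⬝ᵥ (A⁻¹ *ᵥ x.ofLp)))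

/-- The joint density `f(x^n | Σ)` of `n` independent `N(0, Σ)` vectors. -/
def likelihood {M n : ℕ} (x : Fin n → EuclideanSpace ℝ (Fin M))
    (A : Matrix (Fin M) (Fin M) ℝ) : ℝ :=
  ∏ i, gaussDensity A (x i)

/-- The law of `n` independent `N(0, Σ)` vectors. -/
def sampleLaw {M : ℕ} (n : ℕ) (A : Matrix (Fin M) (Fin M) ℝ) :
    Measure (Fin n → EuclideanSpace ℝ (Fin M)) :=
  Measure.pi fun _ => multivariateGaussian 0 A

/-- The statistic `∑ i, x_i x_iᵀ` (without the factor `1/n`). -/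
def scatter {M n : ℕ} (x : Fin n → EuclideanSpace ℝ (Fin M)) : Matrix (Fin M) (Fin M) ℝ :=
  ∑ i, vecMulVec (x i).ofLp (x i).ofLp

/-- Sufficiency of a statistic `T` for a family of laws `P θ`: the conditional law of the sample
given `T` can be chosen independently of `θ`. -/
def IsSufficientStatistic {X τ Θ : Type*} [MeasurableSpace X] [MeasurableSpace τ]
    (P : Θ → Measure X) (T : X → τ) : Prop :=
  Measurable T ∧ ∃ κ : Kernel τ X, IsMarkovKernel κ ∧
    ∀ θ, (P θ).map (fun x => (T x, x)) = ((P θ).map T) ⊗ₘ κ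

/-- The law `W_M(I, n)` of the pivot `U = ∑ i, z_i z_iᵀ`, with `z_1, …, z_n` independent
`N(0, I)` vectors in `ℝ^M`. -/
def pivotLaw (M n : ℕ) : Measure (Matrix (Fin M) (Fin M) ℝ) :=
  (sampleLaw n (1 : Matrix (Fin M) (Fin M) ℝ)).map scatter

/-- The solution `Σ = Ŝ U⁻¹ Ŝᵀ` of the pivotal equation, where `Ŝ` is a square root of the observed
value of the sufficient statistic. -/
def pivotSolution {M : ℕ} (R U : Matrix (Fin M) (Fin M) ℝ) : Matrix (Fin M) (Fin M) ℝ :=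
  R * U⁻¹ * Rᵀ

/-- The distribution that the sufficient statistic method puts on `Σ`: the law of the solution
`Ŝ U⁻¹ Ŝᵀ`, where `Ŝ` is held fixed and `U` is drawn from the law of the pivot. -/
def ssmLaw {M : ℕ} (n : ℕ) (R : Matrix (Fin M) (Fin M) ℝ) : Measure (Matrix (Fin M) (Fin M) ℝ) :=
  (pivotLaw M n).map (pivotSolution R)

/-- The inverse-Wishart density with scale matrix `Ψ` and `ν` degrees of freedom, on `Σ > 0`. -/
def invWishartDensity {M : ℕ} (Ψ : Matrix (Fin M) (Fin M) ℝ) (ν : ℝ)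
    (A : Matrix (Fin M) (Fin M) ℝ) : ℝ :=
  Ψ.det ^ (ν / 2) / ((2 : ℝ) ^ (ν * M / 2) * multiGamma M (ν / 2)) *
    A.det ^ (-((ν + M + 1) / 2)) * etr (-(1 / 2 : ℝ) • (Ψ * A⁻¹))

/-- The inverse-Wishart distribution `W_M^{-1}(Ψ, ν)`. -/
def inverseWishart {M : ℕ} (Ψ : Matrix (Fin M) (Fin M) ℝ) (ν : ℝ) :
    Measure (Matrix (Fin M) (Fin M) ℝ) :=
  ((symVolume M).restrict (posDefSet M)).withDensity
    fun A => ENNReal.ofReal (invWishartDensity Ψ ν A)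

/-- The predictive density `f(y | x^n) = ∫ f(y | Σ) dπ(Σ)` for a distribution `π`
(depending on `x^n`) on the parameter `Σ`. -/
def predictiveDensity {M : ℕ} (π : Measure (Matrix (Fin M) (Fin M) ℝ))
    (y : EuclideanSpace ℝ (Fin M)) : ℝ :=
  ∫ A, gaussDensity A y ∂π

/-- The normalizer `C(x^n) = ∫_{Σ > 0} f(x^n | Σ) dΣ` of the normalized likelihood method. -/
def nlmNormalizer {M n : ℕ} (x : Fin n → EuclideanSpace ℝ (Fin M)) : ℝ :=
  ∫ A in posDefSet M, likelihood x A ∂(symVolume M)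

/-- The distribution that the normalized likelihood method puts on `Σ > 0`, with density
`f(x^n | Σ) / C(x^n)`. -/
def nlmLaw {M n : ℕ} (x : Fin n → EuclideanSpace ℝ (Fin M)) :
    Measure (Matrix (Fin M) (Fin M) ℝ) :=
  ((symVolume M).restrict (posDefSet M)).withDensity
    fun A => ENNReal.ofReal (likelihood x A / nlmNormalizer x)

/-- The sequence `x_1, …, x_n, y`. -/
def appendObs {M n : ℕ} (x : Fin n → EuclideanSpace ℝ (Fin M)) (y : EuclideanSpace ℝ (Fin M)) :
    Fin (n + 1) → EuclideanSpace ℝ (Fin M) :=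
  Fin.snoc x y

end

/-!
Both methods produce inverse-Wishart laws, so everything rests on the law of the pivot
`U = ∑ z_i z_iᵀ`. Its density is found without any matrix decomposition, from the uniqueness of
invariant measures on the cone of positive definite matrices.

A measure on the cone is called invariant if all the maps `V ↦ S V Sᵀ`, with `S` invertible,
preserve it. Since the Jacobian of such a map on symmetric matrices is `det(S)^{M+1}`
(`det_conjUpper`), the measure `det(V)^{-(M+1)/2} dV` is invariant. It is the only one up to a
constant: for an invariant `μ` and the two-sided Haar measure `dg` of the general linear group, the
double integral `∫∫ k(V⁻¹) h(g V gᵀ) dμ(V) dg` splits into a product of single integrals in two ways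
(`IsConjInvariant.lintegral_mul_lintegral`), which shows that `μ` is proportional to the image of
`dg` under `g ↦ g gᵀ`. Two consequences follow.

* For `n ≥ M` almost every sample has a positive definite scatter matrix (`ae_posDef_scatter`). The
  image of Lebesgue measure under the scatter map has the factor `|det S|^{-n}` under `V ↦ S V Sᵀ`,
  so it is `det(V)^{n/2}` times the invariant measure up to a constant. As the Gaussian density is a
  function of the scatter matrix, the density of the pivot follows. Its total mass is one, which
  identifies the constant and shows that `Γ_M(n/2)` is finite and positive. Every value of `Γ_M`
  in the theorem is of this form, so its convergence at other arguments is not needed.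
* The image of the invariant measure under `V ↦ V⁻¹` is invariant, hence a multiple of it, and the
  factor is one because inversion is an involution (`map_inv_invariantVolume`). So `U⁻¹` has the
  inverse-Wishart law, and conjugation by `R` turns the scale matrix `I` into `R Rᵀ`.

In particular the inverse-Wishart density with an integer `m ≥ M` of degrees of freedom integrates
to one. The likelihood of a sample of size `m + M + 1` is a constant times such a density, with `m`
degrees of freedom, and multiplying it by the Gaussian density of a new observation `y` replaces
`(Ψ, m)` by `(Ψ + y yᵀ, m + 1)` up to a constant
(`gaussDensity_mul_invWishartDensity`). The normalizer and the predictive densities are read off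
from these constants. Sufficiency is the factorization of the densities through the scatter matrix.
-/

noncomputable section

/-! ### Measures with densities -/

/-- A density that factors through `f` may be carried along `f`. -/
theorem map_withDensity_comp {α β : Type*} [MeasurableSpace α] [MeasurableSpace β] (μ : Measure α)
    {f : α → β} (hf : Measurable f) {g : β → ENNReal} (hg : Measurable g) :
    (μ.withDensity fun x => g (f x)).map f = (μ.map f).withDensity g := by
  ext s hs
  rw [Measure.map_apply hf hs, withDensity_apply _ (hf hs), withDensity_apply _ hs,
    setLIntegral_map hs hg hf]

/-- Tonelli's theorem for a product of functions of one variable each. -/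
theorem lintegral_pi_prod {n : ℕ} {α : Type*} [MeasurableSpace α] (μ : Fin n → Measure α)
    [∀ i, SigmaFinite (μ i)] {f : Fin n → α → ENNReal} (hf : ∀ i, Measurable (f i)) :
    ∫⁻ x, ∏ i, f i (x i) ∂(Measure.pi μ) = ∏ i, ∫⁻ x, f i x ∂(μ i) := by
  induction n with
  | zero => simp
  | succ n ih =>
    have hm := (measurePreserving_piFinSuccAbove μ 0)
    rw [← hm.symm.lintegral_comp (by fun_prop)]
    simp only [Fin.prod_univ_succ, MeasurableEquiv.piFinSuccAbove_symm_apply,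
      Fin.insertNthEquiv_apply, Fin.insertNth_zero, Fin.cons_zero, Fin.cons_succ]
    refine (lintegral_prod_mul (μ := μ 0) (ν := Measure.pi fun i => μ i.succ)
      (f := f 0) (g := fun z : Fin n → α => ∏ i, f i.succ (z i))
      (hf 0).aemeasurable ?_).trans ?_
    · have := fun i => hf i
      exact Measurable.aemeasurable (by fun_prop)
    · exact congrArg _ (ih (fun i => μ i.succ) fun i => hf i.succ)

/-- A product of measures with densities has the product density. -/
theorem pi_withDensity_prod {n : ℕ} {α : Type*} [MeasurableSpace α] (μ : Fin n → Measure α)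
    [∀ i, SigmaFinite (μ i)] {f : Fin n → α → ENNReal} (hf : ∀ i, Measurable (f i))
    [∀ i, SigmaFinite ((μ i).withDensity (f i))] :
    Measure.pi (fun i => (μ i).withDensity (f i))
      = (Measure.pi μ).withDensity fun x => ∏ i, f i (x i) := by
  refine Measure.pi_eq fun s hs => ?_
  rw [withDensity_apply _ (.univ_pi hs), Measure.restrict_pi_pi, lintegral_pi_prod _ hf]
  exact Finset.prod_congr rfl fun i _ => (withDensity_apply _ (hs i)).symm

/-- Sufficiency from a factorization of the densities: if every law of the family has a density with
respect to one probability measure, and this density is a function of the statistic, then the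
conditional law given the statistic under the reference measure serves for the whole family. -/
theorem isSufficientStatistic_of_withDensity {X τ Θ : Type*} [MeasurableSpace X]
    [StandardBorelSpace X] [Nonempty X] [MeasurableSpace τ] {P : Θ → Measure X} {T : X → τ}
    (hT : Measurable T) (P₀ : Measure X) [IsProbabilityMeasure P₀] (g : Θ → τ → ENNReal)
    (hg : ∀ θ, Measurable (g θ)) (h : ∀ θ, P θ = P₀.withDensity fun x => g θ (T x)) :
    IsSufficientStatistic P T := by
  refine ⟨hT, condDistrib id T P₀, inferInstance, fun θ => ?_⟩
  have h0 : P₀.map T ⊗ₘ condDistrib id T P₀ = P₀.map fun x => (T x, x) :=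
    compProd_map_condDistrib aemeasurable_id
  have h1 : (P θ).map (fun x => (T x, x))
      = (P₀.map fun x => (T x, x)).withDensity fun p => g θ p.1 := by
    rw [h θ]
    exact map_withDensity_comp (g := fun p : τ × X => g θ p.1) P₀ (by fun_prop)
      ((hg θ).comp measurable_fst)
  have h2 : (P θ).map T = (P₀.map T).withDensity (g θ) := by
    rw [h θ]; exact map_withDensity_comp P₀ hT (hg θ)
  rw [h1, h2, ← h0]
  have := hg θ
  refine Measure.ext_of_lintegral _ fun f hf => ?_
  rw [lintegral_withDensity_eq_lintegral_mul _ (by fun_prop) hf,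
    Measure.lintegral_compProd (by fun_prop), Measure.lintegral_compProd hf,
    lintegral_withDensity_eq_lintegral_mul _ (by fun_prop) (by fun_prop)]
  refine lintegral_congr fun a => ?_
  simp only [Pi.mul_apply]
  rw [lintegral_const_mul _ (by fun_prop)]

/-! ### Measurability and positivity of matrices -/

instance matrixBorelSpace (M : ℕ) : BorelSpace (Matrix (Fin M) (Fin M) ℝ) :=
  inferInstanceAs (BorelSpace (Fin M → Fin M → ℝ))

instance matrixSecondCountableTopology (M : ℕ) :
    SecondCountableTopology (Matrix (Fin M) (Fin M) ℝ) :=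
  inferInstanceAs (SecondCountableTopology (Fin M → Fin M → ℝ))

variable {M n : ℕ}

@[fun_prop]
theorem measurable_det : Measurable fun A : Matrix (Fin M) (Fin M) ℝ => A.det :=
  (by fun_prop : Continuous _).measurable

@[fun_prop]
theorem measurable_trace : Measurable fun A : Matrix (Fin M) (Fin M) ℝ => A.trace :=
  (by fun_prop : Continuous _).measurable

@[fun_prop]
theorem measurable_etr : Measurable (etr : Matrix (Fin M) (Fin M) ℝ → ℝ) := by
  unfold etr; fun_prop

@[fun_prop]
theorem measurable_matrix_inv : Measurable fun A : Matrix (Fin M) (Fin M) ℝ => A⁻¹ := by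
  have h : Measurable fun A : Matrix (Fin M) (Fin M) ℝ => A.adjugate :=
    (by fun_prop : Continuous _).measurable
  simp only [Matrix.inv_def, Ring.inverse_eq_inv]
  refine measurable_pi_iff.2 fun i => measurable_pi_iff.2 fun j => ?_
  exact measurable_det.inv.mul (measurable_pi_iff.1 (measurable_pi_iff.1 h i) j)

theorem measurable_matrix_mul {α : Type*} [MeasurableSpace α]
    {f g : α → Matrix (Fin M) (Fin M) ℝ} (hf : Measurable f) (hg : Measurable g) :
    Measurable fun a => f a * g a :=
  (by fun_prop : Continuous fun p : Matrix (Fin M) (Fin M) ℝ × Matrix (Fin M) (Fin M) ℝ =>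
    p.1 * p.2).measurable.comp (hf.prodMk hg)

theorem measurable_matrix_transpose : Measurable fun A : Matrix (Fin M) (Fin M) ℝ => Aᵀ :=
  (by fun_prop : Continuous _).measurable

theorem isClosed_posSemidef : IsClosed {A : Matrix (Fin M) (Fin M) ℝ | A.PosSemidef} := by
  simp only [posSemidef_iff_dotProduct_mulVec, Set.ofPred_and, Set.ofPred_forall]
  refine IsClosed.inter (isClosed_eq (by fun_prop) (by fun_prop)) (isClosed_iInter fun x => ?_)
  exact isClosed_le (by fun_prop) (by fun_prop)

theorem measurableSet_posDefSet : MeasurableSet (posDefSet M) := by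
  have : posDefSet M = {A | A.PosSemidef} ∩ {A | A.det ≠ 0} := by
    ext A
    exact ⟨fun h => ⟨h.posSemidef, h.posSemidef.posDef_iff_det_ne_zero.1 h⟩,
      fun h => h.1.posDef_iff_det_ne_zero.2 h.2⟩
  rw [this]
  exact isClosed_posSemidef.measurableSet.inter
    (measurable_det (measurableSet_singleton 0)).compl

theorem posDef_conj {A S : Matrix (Fin M) (Fin M) ℝ} (hA : A.PosDef) (hS : S.det ≠ 0) :
    (S * A * Sᵀ).PosDef := by
  simpa using hA.mul_mul_conjTranspose_same
    (vecMul_injective_iff_isUnit.2 ((isUnit_iff_isUnit_det S).2 hS.isUnit))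

theorem posDef_conj_iff {A S : Matrix (Fin M) (Fin M) ℝ} (hS : S.det ≠ 0) :
    (S * A * Sᵀ).PosDef ↔ A.PosDef := by
  refine ⟨fun h => ?_, fun h => posDef_conj h hS⟩
  have hu : IsUnit S.det := hS.isUnit
  have hi : S⁻¹.det ≠ 0 := by simpa using hS
  have := posDef_conj h hi
  have e : S⁻¹ * (S * A * Sᵀ) * S⁻¹ᵀ = A := by
    rw [Matrix.mul_assoc, Matrix.mul_assoc, Matrix.mul_assoc, ← Matrix.transpose_mul,
      nonsing_inv_mul _ hu, transpose_one, Matrix.mul_one, ← Matrix.mul_assoc,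
      nonsing_inv_mul _ hu, Matrix.one_mul]
  rwa [e] at this

open scoped MatrixOrder in
/-- Every positive definite matrix has a positive definite square root. -/
theorem exists_posDef_sq {A : Matrix (Fin M) (Fin M) ℝ} (hA : A.PosDef) :
    ∃ Q : Matrix (Fin M) (Fin M) ℝ, Q.PosDef ∧ Q * Q = A := by
  have hs : CFC.sqrt A * CFC.sqrt A = A := CFC.sqrt_mul_sqrt_self A hA.posSemidef.nonneg
  refine ⟨CFC.sqrt A, ?_, hs⟩
  refine (CFC.sqrt_nonneg A).posSemidef.posDef_iff_det_ne_zero.2 fun h0 => hA.det_pos.ne' ?_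
  rw [← hs, det_mul, h0, mul_zero]

theorem det_ne_zero_of_mul_transpose_posDef {A S : Matrix (Fin M) (Fin M) ℝ} (hA : A.PosDef)
    (h : S * Sᵀ = A) : S.det ≠ 0 := by
  intro h0
  refine hA.det_pos.ne' ?_
  rw [← h, det_mul, h0, zero_mul]

theorem Matrix.PosDef.transpose_eq {A : Matrix (Fin M) (Fin M) ℝ} (hA : A.PosDef) : Aᵀ = A := by
  simpa using hA.isHermitian.eq

/-! ### Jacobians of linear actions -/

/-- Lebesgue measure on all real `M × M` matrices. -/
def matVolume (M : ℕ) : Measure (Matrix (Fin M) (Fin M) ℝ) :=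
  (volume : Measure (Fin M → Fin M → ℝ))

instance : SigmaFinite (matVolume M) :=
  inferInstanceAs (SigmaFinite (volume : Measure (Fin M → Fin M → ℝ)))

theorem det_mulRight_matrix (A : Matrix (Fin M) (Fin M) ℝ) :
    LinearMap.det (LinearMap.mulRight ℝ A) = A.det ^ M := by
  have := LinearMap.det_pi (R := ℝ) (ι := Fin M) fun _ => A.vecMulLinear
  have hA : LinearMap.det A.vecMulLinear = A.det := by
    rw [← Matrix.det_transpose A, ← LinearMap.det_toLin']
    congr 1
    ext v
    simp
  simp only [hA, Finset.prod_const, Finset.card_univ, Fintype.card_fin] at this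
  exact this

theorem det_mulLeft_matrix (A : Matrix (Fin M) (Fin M) ℝ) :
    LinearMap.det (LinearMap.mulLeft ℝ A) = A.det ^ M := by
  rw [← det_transpose, ← det_mulRight_matrix,
    ← LinearMap.det_conj (LinearMap.mulLeft ℝ A) (transposeLinearEquiv (Fin M) (Fin M) ℝ ℝ)]
  congr 1
  ext B : 1
  simp [transpose_mul]

theorem map_linearMap_matVolume
    (f : Matrix (Fin M) (Fin M) ℝ →ₗ[ℝ] Matrix (Fin M) (Fin M) ℝ) (hf : LinearMap.det f ≠ 0) :
    (matVolume M).map f = ENNReal.ofReal |(LinearMap.det f)⁻¹| • matVolume M :=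
  Measure.map_linearMap_addHaar_eq_smul_addHaar (E := Fin M → Fin M → ℝ) volume (f := f) hf

theorem map_mulRight_matVolume {A : Matrix (Fin M) (Fin M) ℝ} (hA : A.det ≠ 0) :
    (matVolume M).map (fun g => g * A) = ENNReal.ofReal (|A.det| ^ M)⁻¹ • matVolume M := by
  have := map_linearMap_matVolume (LinearMap.mulRight ℝ A)
    (by rw [det_mulRight_matrix]; exact pow_ne_zero _ hA)
  rwa [det_mulRight_matrix, abs_inv, abs_pow] at this

theorem map_mulLeft_matVolume {A : Matrix (Fin M) (Fin M) ℝ} (hA : A.det ≠ 0) :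
    (matVolume M).map (fun g => A * g) = ENNReal.ofReal (|A.det| ^ M)⁻¹ • matVolume M := by
  have := map_linearMap_matVolume (LinearMap.mulLeft ℝ A)
    (by rw [det_mulLeft_matrix]; exact pow_ne_zero _ hA)
  rwa [det_mulLeft_matrix, abs_inv, abs_pow] at this

theorem symMatrix_isSymm (v : UpperIdx M → ℝ) : (symMatrix v)ᵀ = symMatrix v := by
  ext i j
  simp [symMatrix, min_comm i j, max_comm i j]

theorem symMatrix_upper {A : Matrix (Fin M) (Fin M) ℝ} (hA : Aᵀ = A) :
    symMatrix (fun p : UpperIdx M => A p.1.1 p.1.2) = A := by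
  ext i j
  rcases le_total i j with h | h
  · simp [symMatrix, h]
  · simp only [symMatrix, of_apply, min_eq_right h, max_eq_left h]
    exact congrFun (congrFun hA i) j

theorem measurable_symMatrix : Measurable (symMatrix : (UpperIdx M → ℝ) → _) :=
  measurable_pi_iff.2 fun _ => measurable_pi_iff.2 fun _ => measurable_pi_apply _

/-- The action `V ↦ S V Sᵀ` on symmetric matrices, in the coordinates on and above the diagonal. -/
def conjUpper (S : Matrix (Fin M) (Fin M) ℝ) : (UpperIdx M → ℝ) →ₗ[ℝ] (UpperIdx M → ℝ) where
  toFun v p := (S * symMatrix v * Sᵀ) p.1.1 p.1.2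
  map_add' v w := by
    have : symMatrix (v + w) = symMatrix v + symMatrix w := rfl
    ext p; simp [this, Matrix.mul_add, Matrix.add_mul]
  map_smul' c v := by
    have : symMatrix (c • v) = c • symMatrix v := rfl
    ext p
    rw [this, Matrix.mul_smul, Matrix.smul_mul]
    rfl

theorem symMatrix_conjUpper (S : Matrix (Fin M) (Fin M) ℝ) (v : UpperIdx M → ℝ) :
    symMatrix (conjUpper S v) = S * symMatrix v * Sᵀ :=
  symMatrix_upper (A := S * symMatrix v * Sᵀ)
    (by simp [Matrix.transpose_mul, symMatrix_isSymm, Matrix.mul_assoc])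

theorem conjUpper_mul (S T : Matrix (Fin M) (Fin M) ℝ) :
    conjUpper (S * T) = conjUpper S ∘ₗ conjUpper T := by
  refine LinearMap.ext fun v => funext fun p => ?_
  change (S * T * symMatrix v * (S * T)ᵀ) _ _ = (S * symMatrix (conjUpper T v) * Sᵀ) _ _
  rw [symMatrix_conjUpper T v]
  simp [Matrix.transpose_mul, Matrix.mul_assoc]

theorem conjUpper_one : conjUpper (1 : Matrix (Fin M) (Fin M) ℝ) = LinearMap.id := by
  refine LinearMap.ext fun v => funext fun p => ?_
  change (1 * symMatrix v * 1ᵀ : Matrix (Fin M) (Fin M) ℝ) p.1.1 p.1.2 = v p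
  simp [symMatrix, p.2]

theorem det_conjUpper_mul (S T : Matrix (Fin M) (Fin M) ℝ) :
    LinearMap.det (conjUpper (S * T))
      = LinearMap.det (conjUpper S) * LinearMap.det (conjUpper T) := by
  rw [conjUpper_mul, LinearMap.det_comp]

theorem det_conjUpper_ne_zero {S : Matrix (Fin M) (Fin M) ℝ} (hS : S.det ≠ 0) :
    LinearMap.det (conjUpper S) ≠ 0 := by
  intro h
  have := det_conjUpper_mul S S⁻¹
  rw [mul_nonsing_inv _ hS.isUnit, conjUpper_one, h, zero_mul, LinearMap.det_id] at this
  exact one_ne_zero this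

theorem det_conjUpper_diagonal (d : Fin M → ℝ) :
    LinearMap.det (conjUpper (diagonal d)) = (diagonal d).det ^ (M + 1) := by
  have h : conjUpper (diagonal d)
      = Matrix.toLin' (diagonal fun p : UpperIdx M => d p.1.1 * d p.1.2) := by
    refine LinearMap.ext fun v => funext fun p => ?_
    change (diagonal d * symMatrix v * (diagonal d)ᵀ) _ _ = _
    simp [symMatrix, p.2, mulVec_diagonal]
    ring
  rw [h, LinearMap.det_toLin', det_diagonal, det_diagonal, Finset.prod_mul_distrib,
    ← Finset.prod_pow]
  have h1 (f : Fin M × Fin M → ℝ) :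
      ∏ p : UpperIdx M, f p.1 = ∏ i, ∏ j, if i ≤ j then f (i, j) else 1 := by
    rw [← Fintype.prod_prod_type' (f := fun i j => if i ≤ j then f (i, j) else 1),
      ← Finset.prod_filter, Finset.prod_subtype (p := fun p : Fin M × Fin M => p.1 ≤ p.2)]
    simp
  rw [h1 fun p => d p.1, h1 fun p => d p.2,
    Finset.prod_comm (f := fun i j => if i ≤ j then d (i, j).2 else 1),
    ← Finset.prod_mul_distrib]
  refine Finset.prod_congr rfl fun i _ => ?_
  rw [← Finset.prod_filter, ← Finset.prod_filter]
  simp only [Finset.prod_const]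
  rw [← pow_add]
  congr 1
  have e1 : (Finset.univ.filter fun j => i ≤ j) = Finset.Ici i := by ext; simp
  have e2 : (Finset.univ.filter fun j => j ≤ i) = Finset.Iic i := by ext; simp
  rw [e1, e2, Fin.card_Ici, Fin.card_Iic]
  omega

/-- A transvection is conjugate to its square by a diagonal matrix, so its Jacobian equals its own
square. -/
theorem det_conjUpper_transvection (t : TransvectionStruct (Fin M) ℝ) :
    LinearMap.det (conjUpper t.toMatrix) = 1 := by
  set T := t.toMatrix
  have hT : LinearMap.det (conjUpper T) ≠ 0 := det_conjUpper_ne_zero (by simp [T])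
  let D : Matrix (Fin M) (Fin M) ℝ := diagonal fun k => if k = t.i then 2 else 1
  have hD : D.det ≠ 0 := by
    rw [det_diagonal]
    exact Finset.prod_ne_zero_iff.2 fun k _ => by split_ifs <;> norm_num
  have hc : D * T = T * T * D := by
    have hij := t.hij
    have hTT : T * T = transvection t.i t.j (t.c + t.c) := by
      rw [← transvection_mul_transvection_same _ _ hij]; rfl
    rw [hTT]
    have hD1 : D = 1 + single t.i t.i 1 := by
      ext a b
      rcases eq_or_ne a b with rfl | hab
      · by_cases ha : a = t.i
        · subst ha; simp [D]; norm_num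
        · simp [D, ha, Ne.symm ha]
      · simp only [D, diagonal_apply_ne _ hab, Matrix.add_apply, one_apply_ne hab, single_apply,
          zero_add]
        rw [if_neg fun h => hab (h.1.symm.trans h.2)]
    rw [hD1]
    simp only [T, TransvectionStruct.toMatrix, transvection, Matrix.add_mul, Matrix.mul_add,
      Matrix.mul_one, single_mul_single_same, one_mul,
      single_mul_single_of_ne _ _ _ _ hij.symm, single_add]
    abel
  have := congrArg (fun A => LinearMap.det (conjUpper A)) hc
  simp only [det_conjUpper_mul] at this
  have hD' := det_conjUpper_ne_zero hD
  have h2 : LinearMap.det (conjUpper T) * LinearMap.det (conjUpper T)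
      = LinearMap.det (conjUpper T) := by
    apply mul_right_cancel₀ hD'
    rw [← this, mul_comm]
  exact mul_left_cancel₀ hT (by rw [h2, mul_one])

/-- The Jacobian of `V ↦ S V Sᵀ` on symmetric matrices. -/
theorem det_conjUpper {S : Matrix (Fin M) (Fin M) ℝ} (hS : S.det ≠ 0) :
    LinearMap.det (conjUpper S) = S.det ^ (M + 1) := by
  refine diagonal_transvection_induction_of_det_ne_zero
    (fun S => LinearMap.det (conjUpper S) = S.det ^ (M + 1)) S hS
    (fun d _ => det_conjUpper_diagonal d) (fun t => ?_) fun A B _ _ hA hB => ?_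
  · simp [det_conjUpper_transvection]
  · rw [det_conjUpper_mul, hA, hB, det_mul, mul_pow]

theorem measurable_conj (S : Matrix (Fin M) (Fin M) ℝ) :
    Measurable fun V : Matrix (Fin M) (Fin M) ℝ => S * V * Sᵀ :=
  (by fun_prop : Continuous _).measurable

theorem map_conj_symVolume {S : Matrix (Fin M) (Fin M) ℝ} (hS : S.det ≠ 0) :
    (symVolume M).map (fun V => S * V * Sᵀ)
      = ENNReal.ofReal (|S.det| ^ (M + 1))⁻¹ • symVolume M := by
  have h := Measure.map_linearMap_addHaar_eq_smul_addHaar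
    (volume : Measure (UpperIdx M → ℝ)) (det_conjUpper_ne_zero hS)
  rw [det_conjUpper hS, abs_inv, abs_pow] at h
  have hm : Measurable (conjUpper S) :=
    (LinearMap.continuous_of_finiteDimensional (conjUpper S)).measurable
  rw [symVolume, Measure.map_map (measurable_conj S) measurable_symMatrix, ← Measure.map_smul, ← h,
    Measure.map_map measurable_symMatrix hm]
  congr 1
  ext1 v
  exact (symMatrix_conjUpper S v).symm

instance : SigmaFinite (symVolume M) := by
  have h : (symVolume M).map (fun A (p : UpperIdx M) => A p.1.1 p.1.2) = volume := by
    rw [symVolume, Measure.map_map _ measurable_symMatrix]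
    · have : (fun (A : Matrix (Fin M) (Fin M) ℝ) (p : UpperIdx M) => A p.1.1 p.1.2)
          ∘ symMatrix = id := by
        ext v p
        simp [symMatrix, p.2]
      rw [this, Measure.map_id]
    · exact (by fun_prop : Continuous _).measurable
  have : SigmaFinite ((symVolume M).map (fun A (p : UpperIdx M) => A p.1.1 p.1.2)) := by
    rw [h]; infer_instance
  exact SigmaFinite.of_map _ (by exact (by fun_prop : Continuous _).measurable.aemeasurable) this

/-- Symmetric matrices with entries close to those of the identity are positive definite. -/
theorem posDef_of_abs_sub_one_lt {A : Matrix (Fin M) (Fin M) ℝ} (hA : Aᵀ = A)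
    (h : ∀ i j, |A i j - (1 : Matrix (Fin M) (Fin M) ℝ) i j| ≤ 1 / (M + 1)) : A.PosDef := by
  refine PosDef.of_dotProduct_mulVec_pos (by simpa [IsHermitian] using hA) fun x hx => ?_
  have hpos : 0 < x ⬝ᵥ x := by
    simpa using dotProduct_star_self_pos_iff.2 hx
  have hE : -(1 / ((M : ℝ) + 1) * (M * (x ⬝ᵥ x))) ≤ x ⬝ᵥ ((A - 1) *ᵥ x) := by
    have h1 : x ⬝ᵥ ((A - 1) *ᵥ x) = ∑ i, ∑ j, (A - 1) i j * (x i * x j) := by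
      simp only [dotProduct, mulVec, Finset.mul_sum]
      exact Finset.sum_congr rfl fun i _ => Finset.sum_congr rfl fun j _ => by ring
    have h2 : (M : ℝ) * (x ⬝ᵥ x) = ∑ i, ∑ j, (x i * x i + x j * x j) / 2 := by
      simp only [add_div, Finset.sum_add_distrib, Finset.sum_const, Finset.card_univ,
        Fintype.card_fin, nsmul_eq_mul, ← Finset.mul_sum, ← Finset.sum_div, dotProduct]
      ring
    rw [h1, h2, Finset.mul_sum, ← Finset.sum_neg_distrib]
    refine Finset.sum_le_sum fun i _ => ?_
    rw [Finset.mul_sum, ← Finset.sum_neg_distrib]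
    refine Finset.sum_le_sum fun j _ => ?_
    have hx2 : |x i * x j| ≤ (x i * x i + x j * x j) / 2 :=
      abs_le.2 ⟨by nlinarith [sq_nonneg (x i + x j)], by nlinarith [sq_nonneg (x i - x j)]⟩
    have := mul_le_mul (h i j) hx2 (abs_nonneg _) (by positivity)
    rw [← abs_mul] at this
    exact (neg_le_neg this).trans (neg_abs_le _)
  have hs : x ⬝ᵥ (A *ᵥ x) = x ⬝ᵥ x + x ⬝ᵥ ((A - 1) *ᵥ x) := by
    rw [Matrix.sub_mulVec, one_mulVec, dotProduct_sub]; ring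
  have hM : 1 / ((M : ℝ) + 1) * (M * (x ⬝ᵥ x)) < x ⬝ᵥ x := by
    rw [one_div, inv_mul_lt_iff₀ (by positivity)]
    linarith
  simp only [star_trivial]
  linarith

theorem symVolume_posDefSet_ne_zero : symVolume M (posDefSet M) ≠ 0 := by
  rw [symVolume, Measure.map_apply measurable_symMatrix measurableSet_posDefSet]
  let v₀ : UpperIdx M → ℝ := fun p => (1 : Matrix (Fin M) (Fin M) ℝ) p.1.1 p.1.2
  have hv₀ : symMatrix v₀ = 1 := symMatrix_upper transpose_one
  refine ((Metric.measure_ball_pos volume v₀ (r := 1 / ((M : ℝ) + 1)) (by positivity)).trans_le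
    (measure_mono fun v hv => ?_)).ne'
  refine posDef_of_abs_sub_one_lt (symMatrix_isSymm v) fun i j => ?_
  rw [← hv₀]
  exact (dist_le_pi_dist v v₀ _).trans (Metric.mem_ball.1 hv).le

/-! ### Uniqueness of the invariant measure on positive definite matrices -/

/-- If `f` multiplies the measure `μ` and the density `w` by inverse factors, then it preserves the
measure with density `w`. -/
theorem map_withDensity_eq_self {α : Type*} [MeasurableSpace α] {μ : Measure α} {f : α → α}
    (hf : Measurable f) {w : α → ENNReal} (hw : Measurable w) {d : ENNReal} (h0 : d ≠ 0)
    (ht : d ≠ ⊤) (hμ : μ.map f = d • μ) (hd : ∀ᵐ x ∂μ, w (f x) = d * w x) :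
    (μ.withDensity w).map f = μ.withDensity w := by
  have h1 : μ.withDensity w = μ.withDensity fun x => (fun y => d⁻¹ * w y) (f x) := by
    refine withDensity_congr_ae (hd.mono fun x hx => ?_)
    simp only [hx]
    rw [← mul_assoc, ENNReal.inv_mul_cancel h0 ht, one_mul]
  conv_lhs => rw [h1]
  rw [map_withDensity_comp μ hf (hw.const_mul _), hμ, withDensity_smul_measure]
  change d • μ.withDensity (d⁻¹ • w) = _
  rw [withDensity_smul _ hw, smul_smul, ENNReal.mul_inv_cancel h0 ht, one_smul]

/-- A measure on matrices is invariant if it is carried by the positive definite ones and preserved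
by all the maps `V ↦ S V Sᵀ` with `S` invertible. -/
structure IsConjInvariant (μ : Measure (Matrix (Fin M) (Fin M) ℝ)) : Prop where
  ae_posDef : ∀ᵐ V ∂μ, V.PosDef
  map_conj : ∀ S : Matrix (Fin M) (Fin M) ℝ, S.det ≠ 0 → μ.map (fun V => S * V * Sᵀ) = μ

/-- The two-sided Haar measure `|det g|^{-M} dg` of the general linear group, as a measure on all
matrices. -/
def haarMatrix (M : ℕ) : Measure (Matrix (Fin M) (Fin M) ℝ) :=
  (matVolume M).withDensity fun g => ENNReal.ofReal (|g.det| ^ M)⁻¹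

instance : SFinite (haarMatrix M) := by unfold haarMatrix; infer_instance

theorem map_mulRight_haarMatrix {A : Matrix (Fin M) (Fin M) ℝ} (hA : A.det ≠ 0) :
    (haarMatrix M).map (fun g => g * A) = haarMatrix M := by
  have hp : 0 < |A.det| := abs_pos.2 hA
  refine map_withDensity_eq_self (by exact (by fun_prop : Continuous _).measurable) (by fun_prop)
    (ENNReal.ofReal_pos.2 (by positivity)).ne' ENNReal.ofReal_ne_top
    (map_mulRight_matVolume hA) (ae_of_all _ fun g => ?_)
  rw [← ENNReal.ofReal_mul (by positivity), det_mul, abs_mul, mul_pow, mul_inv, mul_comm]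

theorem map_mulLeft_haarMatrix {A : Matrix (Fin M) (Fin M) ℝ} (hA : A.det ≠ 0) :
    (haarMatrix M).map (fun g => A * g) = haarMatrix M := by
  have hp : 0 < |A.det| := abs_pos.2 hA
  refine map_withDensity_eq_self (by exact (by fun_prop : Continuous _).measurable) (by fun_prop)
    (ENNReal.ofReal_pos.2 (by positivity)).ne' ENNReal.ofReal_ne_top
    (map_mulLeft_matVolume hA) (ae_of_all _ fun g => ?_)
  rw [← ENNReal.ofReal_mul (by positivity), det_mul, abs_mul, mul_pow, mul_inv]

/-- Singular matrices are null for the Haar measure because its density vanishes there (the junk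
value `0⁻¹ = 0`; there are none in dimension zero). -/
theorem ae_det_ne_zero_haarMatrix : ∀ᵐ g ∂haarMatrix M, g.det ≠ 0 := by
  rw [haarMatrix, ae_withDensity_iff (by fun_prop)]
  refine ae_of_all _ fun g hg h0 => hg ?_
  rcases Nat.eq_zero_or_pos M with rfl | hM
  · simp at h0
  · simp [h0, hM.ne']

/-- Evaluating `∫∫ k(V⁻¹) h(g V gᵀ) dμ(V) dg` in two ways: by invariance of the Haar measure the
integral over `g` first gives the left side, by invariance of `μ` the integral over `V` first gives
the right side. -/
theorem IsConjInvariant.lintegral_mul_lintegral {μ : Measure (Matrix (Fin M) (Fin M) ℝ)} [SFinite μ]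
    (hμ : IsConjInvariant μ) {h k : Matrix (Fin M) (Fin M) ℝ → ENNReal} (hh : Measurable h)
    (hk : Measurable k) :
    (∫⁻ V, k V⁻¹ ∂μ) * ∫⁻ g, h (g * gᵀ) ∂(haarMatrix M)
      = (∫⁻ V, h V ∂μ) * ∫⁻ g, k (gᵀ * g) ∂(haarMatrix M) := by
  have hmul : Measurable fun p : Matrix (Fin M) (Fin M) ℝ × Matrix (Fin M) (Fin M) ℝ =>
      p.2 * p.1 * p.2ᵀ := (by fun_prop : Continuous _).measurable
  have hmul' : Measurable fun p : Matrix (Fin M) (Fin M) ℝ × Matrix (Fin M) (Fin M) ℝ =>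
      p.1ᵀ * p.2⁻¹ * p.1 :=
    measurable_matrix_mul (measurable_matrix_mul (measurable_matrix_transpose.comp measurable_fst)
      (measurable_matrix_inv.comp measurable_snd)) measurable_fst
  have hgg : Measurable fun g : Matrix (Fin M) (Fin M) ℝ => g * gᵀ :=
    (by fun_prop : Continuous _).measurable
  have hgg' : Measurable fun g : Matrix (Fin M) (Fin M) ℝ => gᵀ * g :=
    (by fun_prop : Continuous _).measurable
  have h1 : ∫⁻ V, ∫⁻ g, k V⁻¹ * h (g * V * gᵀ) ∂(haarMatrix M) ∂μ
      = (∫⁻ V, k V⁻¹ ∂μ) * ∫⁻ g, h (g * gᵀ) ∂(haarMatrix M) := by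
    rw [← lintegral_mul_const _ (by fun_prop)]
    refine lintegral_congr_ae (hμ.ae_posDef.mono fun V hV => ?_)
    obtain ⟨Q, hQ, rfl⟩ := exists_posDef_sq hV
    dsimp only
    have hm : Measurable fun g => h (g * (Q * Q) * gᵀ) :=
      hh.comp ((by fun_prop : Continuous _).measurable)
    have hm' : Measurable fun g => h (g * gᵀ) := hh.comp hgg
    rw [lintegral_const_mul _ hm]
    congr 1
    conv_rhs => rw [← map_mulRight_haarMatrix (M := M) hQ.det_pos.ne']
    rw [lintegral_map hm' (by exact (by fun_prop : Continuous _).measurable)]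
    refine lintegral_congr fun g => ?_
    rw [Matrix.transpose_mul, hQ.transpose_eq]
    simp only [Matrix.mul_assoc]
  have h2 : ∫⁻ g, ∫⁻ V, k V⁻¹ * h (g * V * gᵀ) ∂μ ∂(haarMatrix M)
      = ∫⁻ g, ∫⁻ V, h V * k (gᵀ * V⁻¹ * g) ∂μ ∂(haarMatrix M) := by
    refine lintegral_congr_ae (ae_det_ne_zero_haarMatrix.mono fun g hg => ?_)
    dsimp only
    conv_rhs => rw [← hμ.map_conj g hg]
    have hm : Measurable fun V => h V * k (gᵀ * V⁻¹ * g) :=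
      hh.mul (hk.comp ((by fun_prop : Continuous fun W => gᵀ * W * g).measurable.comp
        measurable_matrix_inv))
    rw [lintegral_map hm (measurable_conj g)]
    · refine lintegral_congr fun V => ?_
      have hg' : IsUnit g.det := hg.isUnit
      have : gᵀ * (g * V * gᵀ)⁻¹ * g = V⁻¹ := by
        rw [Matrix.mul_inv_rev, Matrix.mul_inv_rev, ← Matrix.mul_assoc,
          mul_nonsing_inv _ (by simpa using hg'),
          Matrix.one_mul, Matrix.mul_assoc, nonsing_inv_mul _ hg', Matrix.mul_one]
      rw [this, mul_comm]
  have h3 : ∫⁻ V, ∫⁻ g, h V * k (gᵀ * V⁻¹ * g) ∂(haarMatrix M) ∂μ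
      = (∫⁻ V, h V ∂μ) * ∫⁻ g, k (gᵀ * g) ∂(haarMatrix M) := by
    rw [← lintegral_mul_const _ hh]
    refine lintegral_congr_ae (hμ.ae_posDef.mono fun V hV => ?_)
    obtain ⟨Q, hQ, hQV⟩ := exists_posDef_sq hV.inv
    dsimp only
    have hm : Measurable fun g => k (gᵀ * V⁻¹ * g) :=
      hk.comp ((by fun_prop : Continuous _).measurable)
    have hm' : Measurable fun g => k (gᵀ * g) := hk.comp hgg'
    rw [lintegral_const_mul _ hm]
    congr 1
    conv_rhs => rw [← map_mulLeft_haarMatrix (M := M) hQ.det_pos.ne']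
    rw [lintegral_map hm' (by exact (by fun_prop : Continuous _).measurable)]
    refine lintegral_congr fun g => ?_
    rw [Matrix.transpose_mul, hQ.transpose_eq, ← hQV]
    simp only [Matrix.mul_assoc]
  rw [← h1, ← h3, lintegral_lintegral_swap, h2, lintegral_lintegral_swap]
  · exact ((hh.comp measurable_snd).mul (hk.comp hmul')).aemeasurable
  · exact ((hk.comp (measurable_matrix_inv.comp measurable_fst)).mul (hh.comp hmul)).aemeasurable

/-- The test function `det(V)^{M/2}`, cut off at trace one: the determinant cancels the density of
the Haar measure, and the cut-off leaves a bounded set of matrices `g`. -/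
def cutoffDet (M : ℕ) (V : Matrix (Fin M) (Fin M) ℝ) : ENNReal :=
  {W : Matrix (Fin M) (Fin M) ℝ | W.trace ≤ 1 ∧ 0 < W.det}.indicator
    (fun W => ENNReal.ofReal (Real.sqrt W.det ^ M)) V

theorem measurable_cutoffDet : Measurable (cutoffDet M) := by
  refine Measurable.indicator (by fun_prop) ?_
  exact (measurableSet_le measurable_trace measurable_const).inter
    (measurableSet_lt measurable_const measurable_det)

theorem lintegral_cutoffDet :
    ∫⁻ g, cutoffDet M (gᵀ * g) ∂(haarMatrix M)
      = matVolume M {g | (gᵀ * g).trace ≤ 1 ∧ g.det ≠ 0} := by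
  have hgg : Measurable fun g : Matrix (Fin M) (Fin M) ℝ => gᵀ * g :=
    (by fun_prop : Continuous _).measurable
  have hs : MeasurableSet {g : Matrix (Fin M) (Fin M) ℝ | (gᵀ * g).trace ≤ 1 ∧ g.det ≠ 0} :=
    (measurableSet_le (measurable_trace.comp hgg) measurable_const).inter
      (measurable_det (measurableSet_singleton 0)).compl
  have hm : Measurable fun g : Matrix (Fin M) (Fin M) ℝ => cutoffDet M (gᵀ * g) :=
    measurable_cutoffDet.comp hgg
  rw [haarMatrix, lintegral_withDensity_eq_lintegral_mul _ (by fun_prop) hm,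
    ← lintegral_indicator_one hs]
  refine lintegral_congr fun g => ?_
  simp only [Pi.mul_apply, cutoffDet, Set.indicator_apply, Set.mem_ofPred_eq, det_mul,
    det_transpose, Pi.one_apply]
  by_cases h0 : g.det = 0
  · simp [h0]
  · have hp : 0 < g.det * g.det := mul_self_pos.2 h0
    have hp' : 0 < |g.det| ^ M := pow_pos (abs_pos.2 h0) _
    simp only [hp, h0, ne_eq, not_false_eq_true, and_true, Real.sqrt_mul_self_eq_abs]
    split_ifs
    · rw [← ENNReal.ofReal_mul (by positivity), inv_mul_cancel₀ hp'.ne', ENNReal.ofReal_one]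
    · simp

theorem trace_transpose_mul_self (g : Matrix (Fin M) (Fin M) ℝ) :
    (gᵀ * g).trace = ∑ i, ∑ j, g j i ^ 2 := by
  simp [trace, Matrix.mul_apply, sq]

theorem lintegral_cutoffDet_ne_top : ∫⁻ g, cutoffDet M (gᵀ * g) ∂(haarMatrix M) ≠ ⊤ := by
  rw [lintegral_cutoffDet]
  have : {g : Matrix (Fin M) (Fin M) ℝ | (gᵀ * g).trace ≤ 1 ∧ g.det ≠ 0}
      ⊆ (Metric.closedBall 0 1 : Set (Fin M → Fin M → ℝ)) := by
    intro g hg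
    have h1 : ∑ i, ∑ j, g j i ^ 2 ≤ 1 := by rw [← trace_transpose_mul_self]; exact hg.1
    refine mem_closedBall_zero_iff.2 ((pi_norm_le_iff_of_nonneg zero_le_one).2 fun j =>
      (pi_norm_le_iff_of_nonneg zero_le_one).2 fun i => ?_)
    have h2 : g j i ^ 2 ≤ ∑ j, g j i ^ 2 :=
      Finset.single_le_sum (f := fun j => g j i ^ 2) (fun _ _ => sq_nonneg _) (Finset.mem_univ j)
    have h3 : ∑ j, g j i ^ 2 ≤ ∑ i, ∑ j, g j i ^ 2 :=
      Finset.single_le_sum (f := fun i => ∑ j, g j i ^ 2)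
        (fun _ _ => Finset.sum_nonneg fun _ _ => sq_nonneg _) (Finset.mem_univ i)
    rw [Real.norm_eq_abs, ← sq_le_one_iff_abs_le_one]
    linarith
  exact ((measure_mono this).trans_lt
    (measure_closedBall_lt_top (μ := (volume : Measure (Fin M → Fin M → ℝ))))).ne

theorem lintegral_cutoffDet_ne_zero : ∫⁻ g, cutoffDet M (gᵀ * g) ∂(haarMatrix M) ≠ 0 := by
  rw [lintegral_cutoffDet]
  have ho : IsOpen {g : Matrix (Fin M) (Fin M) ℝ | (gᵀ * g).trace < 1 ∧ g.det ≠ 0} :=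
    (isOpen_lt (f := fun g : Matrix (Fin M) (Fin M) ℝ => (gᵀ * g).trace) (by fun_prop)
      continuous_const).inter (isOpen_ne_fun (f := fun g : Matrix (Fin M) (Fin M) ℝ => g.det)
        (by fun_prop) continuous_const)
  have hne : ((1 / ((M : ℝ) + 1)) • (1 : Matrix (Fin M) (Fin M) ℝ)) ∈
      {g : Matrix (Fin M) (Fin M) ℝ | (gᵀ * g).trace < 1 ∧ g.det ≠ 0} := by
    constructor
    · have : (M : ℝ) < (M + 1) * (M + 1) := by nlinarith [(Nat.cast_nonneg M : (0 : ℝ) ≤ M)]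
      simp only [transpose_smul, transpose_one, smul_mul, Matrix.one_mul, trace_smul, smul_smul,
        trace_one, Fintype.card_fin, smul_eq_mul]
      rw [one_div, ← mul_inv, inv_mul_lt_iff₀ (by positivity), mul_one]
      exact this
    · simp only [det_smul, det_one, mul_one]
      positivity
  have := IsOpen.measure_pos (volume : Measure (Fin M → Fin M → ℝ)) ho ⟨_, hne⟩
  exact (this.trans_le (measure_mono fun g hg => And.intro (le_of_lt hg.1) hg.2)).ne'

/-- Every invariant measure is a multiple of the image of the Haar measure under `g ↦ g gᵀ`. -/
theorem IsConjInvariant.exists_eq_smul_map {μ : Measure (Matrix (Fin M) (Fin M) ℝ)} [SFinite μ]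
    (hμ : IsConjInvariant μ) :
    ∃ c : ENNReal, μ = c • (haarMatrix M).map fun g => g * gᵀ := by
  have hgg : Measurable fun g : Matrix (Fin M) (Fin M) ℝ => g * gᵀ :=
    (by fun_prop : Continuous _).measurable
  refine ⟨(∫⁻ V, cutoffDet M V⁻¹ ∂μ) / ∫⁻ g, cutoffDet M (gᵀ * g) ∂(haarMatrix M), ?_⟩
  refine Measure.ext_of_lintegral _ fun h hh => ?_
  have key := hμ.lintegral_mul_lintegral hh measurable_cutoffDet
  rw [lintegral_smul_measure, lintegral_map hh hgg, smul_eq_mul, ENNReal.mul_comm_div,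
    ← mul_div_assoc, key, ENNReal.mul_div_cancel_right lintegral_cutoffDet_ne_zero
      lintegral_cutoffDet_ne_top]

theorem exists_measure_pos_lt_top {α : Type*} [MeasurableSpace α] {μ : Measure α} [SigmaFinite μ]
    (h0 : μ ≠ 0) : ∃ s, μ s ≠ 0 ∧ μ s ≠ ⊤ := by
  obtain ⟨t, -, -, h1, h2⟩ := Measure.exists_subset_measure_lt_top MeasurableSet.univ
    (Measure.measure_univ_pos.2 h0)
  exact ⟨t, h1.ne', h2.ne⟩

/-- The invariant measure is unique up to a constant. -/
theorem IsConjInvariant.exists_eq_smul {μ μ' : Measure (Matrix (Fin M) (Fin M) ℝ)} [SFinite μ']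
    [SigmaFinite μ] (hμ' : IsConjInvariant μ') (hμ : IsConjInvariant μ) (h0 : μ ≠ 0) :
    ∃ c : ENNReal, μ' = c • μ := by
  obtain ⟨c', hc'⟩ := hμ'.exists_eq_smul_map
  obtain ⟨c, hc⟩ := hμ.exists_eq_smul_map
  have hc0 : c ≠ 0 := by
    rintro rfl
    exact h0 (by rw [hc, zero_smul])
  have hct : c ≠ ⊤ := by
    rintro rfl
    obtain ⟨t, h1, h2⟩ := exists_measure_pos_lt_top h0
    rw [hc, Measure.smul_apply, smul_eq_mul] at h1 h2
    exact h2 (ENNReal.top_mul (right_ne_zero_of_mul h1))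
  refine ⟨c' * c⁻¹, ?_⟩
  rw [hc, smul_smul, mul_assoc, ENNReal.inv_mul_cancel hc0 hct, mul_one]
  exact hc'

/-! ### The invariant measure -/

/-- Lebesgue measure `dV` on `V > 0`. -/
abbrev posDefVolume (M : ℕ) : Measure (Matrix (Fin M) (Fin M) ℝ) :=
  (symVolume M).restrict (posDefSet M)

/-- The invariant measure `det(V)^{-(M+1)/2} dV` on `V > 0`. -/
def invariantVolume (M : ℕ) : Measure (Matrix (Fin M) (Fin M) ℝ) :=
  (posDefVolume M).withDensity fun V => ENNReal.ofReal (V.det ^ (-(((M : ℝ) + 1) / 2)))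

instance : SigmaFinite (invariantVolume M) := by unfold invariantVolume; infer_instance

theorem ae_posDef_posDefVolume : ∀ᵐ V ∂posDefVolume M, V.PosDef :=
  ae_restrict_mem measurableSet_posDefSet

theorem map_conj_posDefVolume {S : Matrix (Fin M) (Fin M) ℝ} (hS : S.det ≠ 0) :
    (posDefVolume M).map (fun V => S * V * Sᵀ)
      = ENNReal.ofReal (|S.det| ^ (M + 1))⁻¹ • posDefVolume M := by
  have hpre : (fun V : Matrix (Fin M) (Fin M) ℝ => S * V * Sᵀ) ⁻¹' posDefSet M = posDefSet M := by
    ext V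
    exact posDef_conj_iff hS
  have := Measure.restrict_map (μ := symVolume M) (measurable_conj S) measurableSet_posDefSet
  rw [hpre, map_conj_symVolume hS, Measure.restrict_smul] at this
  exact this.symm

theorem det_conj_rpow (S : Matrix (Fin M) (Fin M) ℝ) {V : Matrix (Fin M) (Fin M) ℝ}
    (hV : V.PosDef) (a : ℕ) (s : ℝ) :
    (S * V * Sᵀ).det ^ (s * (a / 2)) = (|S.det| ^ a) ^ s * V.det ^ (s * (a / 2)) := by
  have h : (S * V * Sᵀ).det = |S.det| ^ (2 : ℝ) * V.det := by
    rw [det_mul, det_mul, det_transpose, Real.rpow_two, sq_abs]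
    ring
  rw [h, Real.mul_rpow (by positivity) hV.det_pos.le, ← Real.rpow_mul (abs_nonneg _),
    ← Real.rpow_natCast, ← Real.rpow_mul (abs_nonneg _)]
  congr 2
  ring

theorem isConjInvariant_invariantVolume : IsConjInvariant (invariantVolume M) where
  ae_posDef := (withDensity_absolutelyContinuous _ _).ae_le ae_posDef_posDefVolume
  map_conj S hS := by
    have hp : 0 < |S.det| := abs_pos.2 hS
    refine map_withDensity_eq_self (measurable_conj S) (by fun_prop)
      (ENNReal.ofReal_pos.2 (by positivity)).ne' ENNReal.ofReal_ne_top
      (map_conj_posDefVolume hS) (ae_posDef_posDefVolume.mono fun V hV => ?_)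
    have := det_conj_rpow S hV (M + 1) (-1)
    push_cast at this
    rw [neg_one_mul, Real.rpow_neg_one] at this
    rw [this, ENNReal.ofReal_mul (by positivity)]

theorem invariantVolume_ne_zero : invariantVolume M ≠ 0 := by
  intro h
  have h1 : posDefVolume M ≪ invariantVolume M :=
    withDensity_absolutelyContinuous' (by fun_prop)
      (ae_posDef_posDefVolume.mono fun V hV =>
        (ENNReal.ofReal_pos.2 (Real.rpow_pos_of_pos hV.det_pos _)).ne')
  rw [h, Measure.absolutelyContinuous_zero_iff, Measure.restrict_eq_zero] at h1
  exact symVolume_posDefSet_ne_zero h1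

/-- The invariant measure is preserved by matrix inversion: its image is invariant too, hence a
multiple of it, and the factor is one because inversion is an involution. -/
theorem map_inv_invariantVolume :
    (invariantVolume M).map (fun V => V⁻¹) = invariantVolume M := by
  have hinv := isConjInvariant_invariantVolume (M := M)
  have h1 : IsConjInvariant ((invariantVolume M).map fun V => V⁻¹) :=
    { ae_posDef := (ae_map_iff measurable_matrix_inv.aemeasurable measurableSet_posDefSet).2
        (hinv.ae_posDef.mono fun V hV => hV.inv)
      map_conj := fun S hS => by
        have hS' : (S⁻¹ᵀ).det ≠ 0 := by simpa using hS
        conv_rhs => rw [← hinv.map_conj _ hS']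
        rw [Measure.map_map (measurable_conj S) measurable_matrix_inv,
          Measure.map_map measurable_matrix_inv (measurable_conj _)]
        congr 1
        ext1 V
        simp only [Function.comp_apply, Matrix.mul_inv_rev, transpose_transpose]
        rw [transpose_nonsing_inv, nonsing_inv_nonsing_inv _ hS.isUnit,
          nonsing_inv_nonsing_inv _ (by simpa using hS.isUnit), Matrix.mul_assoc] }
  obtain ⟨c, hc⟩ := h1.exists_eq_smul hinv invariantVolume_ne_zero
  have h2 : ((invariantVolume M).map fun V => V⁻¹).map (fun V => V⁻¹) = invariantVolume M := by
    rw [Measure.map_map measurable_matrix_inv measurable_matrix_inv]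
    conv_rhs => rw [← Measure.map_id (μ := invariantVolume M)]
    exact Measure.map_congr (hinv.ae_posDef.mono fun V hV =>
      nonsing_inv_nonsing_inv _ hV.det_pos.ne'.isUnit)
  rw [hc, Measure.map_smul, hc, smul_smul] at h2
  obtain ⟨t, ht0, ht⟩ := exists_measure_pos_lt_top (invariantVolume_ne_zero (M := M))
  have h3 := congrArg (fun μ => μ t) h2
  simp only [Measure.smul_apply, smul_eq_mul] at h3
  have h4 : c * c = 1 := by
    have := ENNReal.mul_div_cancel_right ht0 ht (a := c * c)
    rw [h3, ENNReal.div_self ht0 ht] at this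
    exact this.symm
  have h5 : c = 1 := by
    rcases lt_trichotomy c 1 with h | h | h
    · exact absurd h4 (by simpa using (ENNReal.mul_lt_mul h h).ne)
    · exact h
    · exact absurd h4 (by simpa using (ENNReal.mul_lt_mul h h).ne')
  rw [hc, h5, one_smul]

/-! ### Gaussian samples and their scatter matrices -/

theorem sqrt_pow_eq {x : ℝ} (hx : 0 ≤ x) (k : ℕ) : Real.sqrt (x ^ k) = Real.sqrt x ^ k := by
  induction k with
  | zero => simp
  | succ k ih => rw [pow_succ, Real.sqrt_mul (pow_nonneg hx k), ih, pow_succ]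

/-- The joint density `f(x^n | Σ)` as a function of the scatter matrix `T` of the sample. -/
def likelihoodOfScatter (n : ℕ) (A T : Matrix (Fin M) (Fin M) ℝ) : ℝ :=
  1 / Real.sqrt ((2 * Real.pi) ^ (M * n) * A.det ^ n) * etr (-(1 / 2 : ℝ) • (T * A⁻¹))

theorem scatter_eq_mul_transpose (x : Fin n → EuclideanSpace ℝ (Fin M)) :
    scatter x = (Matrix.of fun a i => x i a) * (Matrix.of fun a i => x i a)ᵀ := by
  ext a b
  simp [scatter, Matrix.sum_apply, vecMulVec_apply, Matrix.mul_apply]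

@[fun_prop]
theorem measurable_scatter :
    Measurable (scatter : (Fin n → EuclideanSpace ℝ (Fin M)) → Matrix (Fin M) (Fin M) ℝ) := by
  simp only [funext scatter_eq_mul_transpose]
  exact (by fun_prop : Continuous _).measurable

theorem scatter_mulVec (S : Matrix (Fin M) (Fin M) ℝ) (z : Fin n → EuclideanSpace ℝ (Fin M)) :
    scatter (fun i => WithLp.toLp 2 (S *ᵥ (z i).ofLp)) = S * scatter z * Sᵀ := by
  simp only [scatter, Matrix.mul_sum, Matrix.sum_mul]
  refine Finset.sum_congr rfl fun i _ => ?_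
  rw [mul_vecMulVec, vecMulVec_mul, vecMul_transpose]

theorem trace_scatter_mul (x : Fin n → EuclideanSpace ℝ (Fin M)) (B : Matrix (Fin M) (Fin M) ℝ) :
    (scatter x * B).trace = ∑ i, (x i).ofLp ⬝ᵥ (B *ᵥ (x i).ofLp) := by
  simp only [scatter, Matrix.sum_mul, trace_sum]
  refine Finset.sum_congr rfl fun i _ => ?_
  rw [vecMulVec_mul, trace_vecMulVec, dotProduct_comm, ← dotProduct_mulVec]

theorem likelihood_eq_likelihoodOfScatter {A : Matrix (Fin M) (Fin M) ℝ} (hA : A.PosDef)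
    (x : Fin n → EuclideanSpace ℝ (Fin M)) :
    likelihood x A = likelihoodOfScatter n A (scatter x) := by
  have h0 : 0 ≤ (2 * Real.pi) ^ M * A.det := mul_nonneg (by positivity) hA.det_pos.le
  simp only [likelihood, gaussDensity, likelihoodOfScatter, etr, Finset.prod_mul_distrib,
    Finset.prod_const, Finset.card_univ, Fintype.card_fin, ← Real.exp_sum, trace_smul,
    trace_scatter_mul, smul_eq_mul, Finset.mul_sum]
  rw [div_pow, one_pow, ← sqrt_pow_eq h0, mul_pow, ← pow_mul]

theorem likelihoodOfScatter_pos {A : Matrix (Fin M) (Fin M) ℝ} (hA : A.PosDef)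
    (T : Matrix (Fin M) (Fin M) ℝ) : 0 < likelihoodOfScatter n A T := by
  have := hA.det_pos
  unfold likelihoodOfScatter etr
  positivity

@[fun_prop]
theorem measurable_likelihoodOfScatter (A : Matrix (Fin M) (Fin M) ℝ) :
    Measurable (likelihoodOfScatter n A) := by
  unfold likelihoodOfScatter
  exact (measurable_etr.comp (by fun_prop : Continuous _).measurable).const_mul _

theorem gaussDensity_nonneg (A : Matrix (Fin M) (Fin M) ℝ) (x : EuclideanSpace ℝ (Fin M)) :
    0 ≤ gaussDensity A x := by
  unfold gaussDensity; positivity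

@[fun_prop]
theorem measurable_gaussDensity (A : Matrix (Fin M) (Fin M) ℝ) : Measurable (gaussDensity A) := by
  unfold gaussDensity
  exact (by fun_prop : Continuous _).measurable

/-- The linear map `(z_1, …, z_n) ↦ (S z_1, …, S z_n)`. -/
def sampleMulVec (n : ℕ) (S : Matrix (Fin M) (Fin M) ℝ) :
    (Fin n → EuclideanSpace ℝ (Fin M)) →ₗ[ℝ] (Fin n → EuclideanSpace ℝ (Fin M)) :=
  LinearMap.pi fun i =>
    ((WithLp.linearEquiv 2 ℝ (Fin M → ℝ)).symm.toLinearMap ∘ₗ toLin' S ∘ₗ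
      (WithLp.linearEquiv 2 ℝ (Fin M → ℝ)).toLinearMap) ∘ₗ LinearMap.proj i

theorem map_sample_volume {S : Matrix (Fin M) (Fin M) ℝ} (hS : S.det ≠ 0) :
    (volume : Measure (Fin n → EuclideanSpace ℝ (Fin M))).map
        (fun z i => WithLp.toLp 2 (S *ᵥ (z i).ofLp))
      = ENNReal.ofReal (|S.det| ^ n)⁻¹ • volume := by
  have hd : LinearMap.det (sampleMulVec n S) = S.det ^ n := by
    rw [sampleMulVec, LinearMap.det_pi]
    have := LinearMap.det_conj (toLin' S) (WithLp.linearEquiv 2 ℝ (Fin M → ℝ)).symm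
    rw [LinearEquiv.symm_symm, LinearMap.det_toLin'] at this
    simp only [this, Finset.prod_const, Finset.card_univ, Fintype.card_fin]
  have := Measure.map_linearMap_addHaar_eq_smul_addHaar
    (volume : Measure (Fin n → EuclideanSpace ℝ (Fin M))) (f := sampleMulVec n S)
    (by rw [hd]; exact pow_ne_zero _ hS)
  rw [hd, abs_inv, abs_pow] at this
  exact this

theorem map_mulVec_volume {S : Matrix (Fin M) (Fin M) ℝ} (hS : S.det ≠ 0) :
    (volume : Measure (EuclideanSpace ℝ (Fin M))).map
        (fun x => WithLp.toLp 2 (S *ᵥ x.ofLp)) = ENNReal.ofReal |S.det|⁻¹ • volume := by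
  have hd := LinearMap.det_conj (toLin' S) (WithLp.linearEquiv 2 ℝ (Fin M → ℝ)).symm
  rw [LinearEquiv.symm_symm, LinearMap.det_toLin'] at hd
  have := Measure.map_linearMap_addHaar_eq_smul_addHaar
    (volume : Measure (EuclideanSpace ℝ (Fin M))) (by rw [hd]; exact hS)
  rw [hd, abs_inv] at this
  exact this

theorem stdGaussian_eq_withDensity :
    stdGaussian (EuclideanSpace ℝ (Fin M))
      = volume.withDensity fun x => ENNReal.ofReal (gaussDensity 1 x) := by
  have hvol := (PiLp.volume_preserving_toLp (Fin M)).map_eq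
  have hprod : ∀ x : Fin M → ℝ, ∏ i, gaussianPDF 0 1 (x i)
      = ENNReal.ofReal (gaussDensity 1 (WithLp.toLp 2 x)) := by
    intro x
    simp only [gaussianPDF, gaussianPDFReal, gaussDensity]
    rw [← ENNReal.ofReal_prod_of_nonneg fun i _ => by positivity, Finset.prod_mul_distrib,
      ← Real.exp_sum]
    congr 2
    · rw [Finset.prod_const, Finset.card_univ, Fintype.card_fin, det_one, mul_one,
        sqrt_pow_eq Real.two_pi_pos.le, NNReal.coe_one, mul_one, inv_pow, one_div]
    · simp only [inv_one, one_mulVec, dotProduct, Finset.mul_sum, NNReal.coe_one]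
      congr 1
      exact Finset.sum_congr rfl fun i _ => by ring
  have hg : gaussianReal 0 1 = volume.withDensity (gaussianPDF 0 1) :=
    gaussianReal_of_var_ne_zero 0 one_ne_zero
  have : SigmaFinite ((volume : Measure ℝ).withDensity (gaussianPDF 0 1)) := by
    rw [← hg]; infer_instance
  rw [← map_pi_eq_stdGaussian, hg, pi_withDensity_prod _ fun _ => measurable_gaussianPDF 0 1,
    funext hprod, map_withDensity_comp (f := WithLp.toLp 2)
      (g := fun x => ENNReal.ofReal (gaussDensity 1 x)) _ (by fun_prop) (by fun_prop)]
  rw [← volume_pi, hvol]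

theorem abs_det_mul_gaussDensity {A S : Matrix (Fin M) (Fin M) ℝ} (hA : A.PosDef)
    (h : S * Sᵀ = A) (x : EuclideanSpace ℝ (Fin M)) :
    |S.det| * gaussDensity A (WithLp.toLp 2 (S *ᵥ x.ofLp)) = gaussDensity 1 x := by
  have hS := det_ne_zero_of_mul_transpose_posDef hA h
  have hd : A.det = |S.det| ^ 2 := by rw [← h, det_mul, det_transpose, sq_abs, sq]
  have hq : (S *ᵥ x.ofLp) ⬝ᵥ (A⁻¹ *ᵥ (S *ᵥ x.ofLp)) = x.ofLp ⬝ᵥ x.ofLp := by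
    have : Sᵀ * (A⁻¹ * S) = 1 := by
      rw [← h, Matrix.mul_inv_rev, ← Matrix.mul_assoc, ← Matrix.mul_assoc,
        mul_nonsing_inv _ (by simpa using hS.isUnit), Matrix.one_mul, nonsing_inv_mul _ hS.isUnit]
    rw [mulVec_mulVec, ← vecMul_transpose, ← dotProduct_mulVec, mulVec_mulVec, this, one_mulVec]
  have hp : 0 < |S.det| := abs_pos.2 hS
  simp only [gaussDensity, hq, hd, det_one, mul_one, inv_one, one_mulVec]
  rw [Real.sqrt_mul (by positivity), Real.sqrt_sq hp.le]
  field_simp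

/-- A square root of the covariance matrix maps the standard Gaussian law to the law with the
Gaussian density. -/
theorem map_stdGaussian_mulVec {A S : Matrix (Fin M) (Fin M) ℝ} (hA : A.PosDef)
    (h : S * Sᵀ = A) :
    (stdGaussian (EuclideanSpace ℝ (Fin M))).map (fun x => WithLp.toLp 2 (S *ᵥ x.ofLp))
      = volume.withDensity fun x => ENNReal.ofReal (gaussDensity A x) := by
  have hS := det_ne_zero_of_mul_transpose_posDef hA h
  have hp : 0 < |S.det| := abs_pos.2 hS
  have hm : Measurable fun x : EuclideanSpace ℝ (Fin M) => WithLp.toLp 2 (S *ᵥ x.ofLp) :=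
    (by fun_prop : Continuous _).measurable
  simp only [stdGaussian_eq_withDensity, ← abs_det_mul_gaussDensity hA h]
  rw [map_withDensity_comp (g := fun y => ENNReal.ofReal (|S.det| * gaussDensity A y)) _ hm
    (by fun_prop), map_mulVec_volume hS, withDensity_smul_measure,
    ← withDensity_smul _ (by fun_prop)]
  congr 1
  ext1 y
  rw [Pi.smul_apply, smul_eq_mul, ← ENNReal.ofReal_mul (by positivity), ← mul_assoc,
    inv_mul_cancel₀ hp.ne', one_mul]

open scoped MatrixOrder in
theorem multivariateGaussian_eq_withDensity {A : Matrix (Fin M) (Fin M) ℝ} (hA : A.PosDef) :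
    multivariateGaussian 0 A = volume.withDensity fun x => ENNReal.ofReal (gaussDensity A x) := by
  have hs : CFC.sqrt A * CFC.sqrt A = A := CFC.sqrt_mul_sqrt_self A hA.posSemidef.nonneg
  have ht : (CFC.sqrt A)ᵀ = CFC.sqrt A := by
    simpa using (CFC.sqrt_nonneg A).posSemidef.isHermitian.eq
  rw [← map_stdGaussian_mulVec hA (S := CFC.sqrt A) (by rw [ht, hs]), multivariateGaussian]
  congr 1
  ext1 x
  rw [zero_add]
  rfl

theorem sampleLaw_eq_withDensity {A : Matrix (Fin M) (Fin M) ℝ} (hA : A.PosDef) :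
    sampleLaw n A = (volume : Measure (Fin n → EuclideanSpace ℝ (Fin M))).withDensity
      fun x => ENNReal.ofReal (likelihood x A) := by
  rw [sampleLaw, multivariateGaussian_eq_withDensity hA, pi_withDensity_prod _ fun _ => by fun_prop,
    ← volume_pi]
  congr 1
  ext1 x
  rw [likelihood, ENNReal.ofReal_prod_of_nonneg fun i _ => gaussDensity_nonneg _ _]

instance (A : Matrix (Fin M) (Fin M) ℝ) : IsProbabilityMeasure (sampleLaw n A) := by
  unfold sampleLaw; infer_instance

instance : IsProbabilityMeasure (pivotLaw M n) :=
  Measure.isProbabilityMeasure_map measurable_scatter.aemeasurable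

theorem map_sampleLaw_one {A S : Matrix (Fin M) (Fin M) ℝ} (hA : A.PosDef) (h : S * Sᵀ = A) :
    (sampleLaw n (1 : Matrix (Fin M) (Fin M) ℝ)).map
      (fun z i => WithLp.toLp 2 (S *ᵥ (z i).ofLp)) = sampleLaw n A := by
  have hm : Measurable fun x : EuclideanSpace ℝ (Fin M) => WithLp.toLp 2 (S *ᵥ x.ofLp) :=
    (by fun_prop : Continuous _).measurable
  have hmap : (multivariateGaussian 0 (1 : Matrix (Fin M) (Fin M) ℝ)).map
      (fun x => WithLp.toLp 2 (S *ᵥ x.ofLp)) = multivariateGaussian 0 A := by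
    rw [multivariateGaussian_zero_one, map_stdGaussian_mulVec hA h,
      multivariateGaussian_eq_withDensity hA]
  have : SigmaFinite ((multivariateGaussian 0 (1 : Matrix (Fin M) (Fin M) ℝ)).map
      (fun x => WithLp.toLp 2 (S *ᵥ x.ofLp))) := by
    rw [hmap]; infer_instance
  rw [sampleLaw, Measure.pi_map_pi fun _ => hm.aemeasurable, hmap, sampleLaw]

theorem isSufficientStatistic_scatter :
    IsSufficientStatistic
      (fun A : {A : Matrix (Fin M) (Fin M) ℝ // A.PosDef} => sampleLaw n A.1) scatter := by
  refine isSufficientStatistic_of_withDensity measurable_scatter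
    (sampleLaw n (1 : Matrix (Fin M) (Fin M) ℝ))
    (fun A T => ENNReal.ofReal (likelihoodOfScatter n A.1 T / likelihoodOfScatter n 1 T))
    (fun A => by fun_prop) fun A => ?_
  have h1 : (1 : Matrix (Fin M) (Fin M) ℝ).PosDef := PosDef.one
  rw [sampleLaw_eq_withDensity A.2, sampleLaw_eq_withDensity h1]
  simp only [likelihood_eq_likelihoodOfScatter A.2, likelihood_eq_likelihoodOfScatter h1]
  rw [← withDensity_mul _ (by fun_prop) (by fun_prop)]
  congr 1
  ext1 x
  have hp := likelihoodOfScatter_pos (n := n) h1 (scatter x)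
  rw [Pi.mul_apply, ← ENNReal.ofReal_mul hp.le, mul_div_cancel₀ _ hp.ne']

/-- Translating `n ≥ M` vectors along the first `M` coordinate vectors makes their scatter matrix
nonsingular except at the eigenvalues of a square matrix. -/
theorem finite_not_posDef_scatter_translate (h : M ≤ n) (z : Fin n → EuclideanSpace ℝ (Fin M)) :
    {t : ℝ | ¬ (scatter (z + t • fun i : Fin n =>
      (WithLp.toLp 2 fun a : Fin M => if (a : ℕ) = i then (1 : ℝ) else 0))).PosDef}.Finite := by
  let g : Matrix (Fin M) (Fin M) ℝ := Matrix.of fun a j => - z (Fin.castLE h j) a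
  refine (g.charpoly.roots.toFinset.finite_toSet).subset fun t ht => ?_
  rw [Finset.mem_coe, Multiset.mem_toFinset, Polynomial.mem_roots g.charpoly_monic.ne_zero,
    Polynomial.IsRoot, eval_charpoly]
  by_contra h0
  refine ht ?_
  rw [scatter_eq_mul_transpose]
  set Z : Matrix (Fin M) (Fin n) ℝ := Matrix.of fun a i => (z + t • fun i : Fin n =>
      (WithLp.toLp 2 fun a : Fin M => if (a : ℕ) = i then (1 : ℝ) else 0)) i a with hZ
  have hsub : Z.submatrix id (Fin.castLE h) = scalar (Fin M) t - g := by
    ext a j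
    rcases eq_or_ne a j with rfl | haj
    · simp [hZ, g]; ring
    · have : (a : ℕ) ≠ j := fun e => haj (Fin.ext e)
      simp [hZ, g, haj, this]
  have hinj : Function.Injective Z.vecMul := by
    intro x y hxy
    refine vecMul_injective_iff_isUnit.2 ((isUnit_iff_isUnit_det _).2 (Ne.isUnit h0)) ?_
    rw [← hsub]
    ext j
    exact congrFun hxy (Fin.castLE h j)
  simpa using PosDef.mul_conjTranspose_self Z hinj

/-- Almost every configuration of `n ≥ M` vectors has a positive definite scatter matrix: by
translation invariance it suffices that almost every translate along a fixed line does. -/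
theorem ae_posDef_scatter (h : M ≤ n) :
    ∀ᵐ z : Fin n → EuclideanSpace ℝ (Fin M), (scatter z).PosDef := by
  set e : Fin n → EuclideanSpace ℝ (Fin M) := fun i : Fin n =>
      (WithLp.toLp 2 fun a : Fin M => if (a : ℕ) = i then (1 : ℝ) else 0) with he
  have hms : MeasurableSet {z : Fin n → EuclideanSpace ℝ (Fin M) | ¬ (scatter z).PosDef} :=
    (measurable_scatter measurableSet_posDefSet).compl
  have hmt : Measurable fun p : (Fin n → EuclideanSpace ℝ (Fin M)) × ℝ => p.1 + p.2 • e := by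
    fun_prop
  have h1 : ∀ᵐ z : Fin n → EuclideanSpace ℝ (Fin M), ∀ᵐ t : ℝ, (scatter (z + t • e)).PosDef :=
    ae_of_all _ fun z => by
      rw [ae_iff]
      exact (finite_not_posDef_scatter_translate h z).measure_zero _
  have h2 : ∀ᵐ t : ℝ, ∀ᵐ z : Fin n → EuclideanSpace ℝ (Fin M), (scatter (z + t • e)).PosDef :=
    (Measure.ae_ae_comm (p := fun z t => (scatter (z + t • e)).PosDef)
      (hmt (measurable_scatter measurableSet_posDefSet))).1 h1
  obtain ⟨t, ht⟩ := h2.exists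
  rw [ae_iff] at ht ⊢
  rw [← measure_preimage_add_right volume (t • e)]
  exact ht

/-! ### The Wishart law of the pivot -/

/-- The unnormalized Wishart density `det(V)^{a/2} etr(-V/2)` with respect to the invariant
measure. -/
def wishartKernel (a : ℝ) (V : Matrix (Fin M) (Fin M) ℝ) : ℝ :=
  V.det ^ (a / 2) * etr (-(1 / 2 : ℝ) • V)

@[fun_prop]
theorem measurable_wishartKernel (a : ℝ) :
    Measurable (wishartKernel a : Matrix (Fin M) (Fin M) ℝ → ℝ) := by
  unfold wishartKernel
  exact (by fun_prop : Measurable _).mul (measurable_etr.comp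
    (by fun_prop : Continuous _).measurable)

theorem ae_posDef_invariantVolume : ∀ᵐ V ∂invariantVolume M, V.PosDef :=
  isConjInvariant_invariantVolume.ae_posDef

/-- For `n ≥ M` the image of Lebesgue measure under the scatter matrix is a multiple of
`det(V)^{n/2}` times the invariant measure, because it transforms with the factor `|det S|^{-n}`
under `V ↦ S V Sᵀ`. -/
theorem exists_map_scatter_volume (h : M ≤ n) :
    ∃ c : ENNReal, (volume : Measure (Fin n → EuclideanSpace ℝ (Fin M))).map scatter
      = c • (invariantVolume M).withDensity fun V => ENNReal.ofReal (V.det ^ ((n : ℝ) / 2)) := by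
  set μ := (volume : Measure (Fin n → EuclideanSpace ℝ (Fin M))).map scatter with hμ
  have hpos : ∀ᵐ V ∂μ, V.PosDef :=
    (ae_map_iff measurable_scatter.aemeasurable measurableSet_posDefSet).2 (ae_posDef_scatter h)
  have hrel : ∀ S : Matrix (Fin M) (Fin M) ℝ, S.det ≠ 0 →
      μ.map (fun V => S * V * Sᵀ) = ENNReal.ofReal (|S.det| ^ n)⁻¹ • μ := by
    intro S hS
    have hm : Measurable fun (z : Fin n → EuclideanSpace ℝ (Fin M)) (i : Fin n) =>
        WithLp.toLp 2 (S *ᵥ (z i).ofLp) := (by fun_prop : Continuous _).measurable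
    rw [hμ, ← Measure.map_smul, ← map_sample_volume hS, Measure.map_map measurable_scatter hm,
      Measure.map_map (measurable_conj S) measurable_scatter]
    congr 1
    ext1 z
    exact (scatter_mulVec S z).symm
  have hinv : IsConjInvariant
      (μ.withDensity fun V => ENNReal.ofReal (V.det ^ (-((n : ℝ) / 2)))) :=
    { ae_posDef := (withDensity_absolutelyContinuous _ _).ae_le hpos
      map_conj := fun S hS => by
        have hp : 0 < |S.det| := abs_pos.2 hS
        refine map_withDensity_eq_self (measurable_conj S) (by fun_prop)
          (ENNReal.ofReal_pos.2 (by positivity)).ne' ENNReal.ofReal_ne_top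
          (hrel S hS) (hpos.mono fun V hV => ?_)
        have := det_conj_rpow S hV n (-1)
        rw [neg_one_mul, Real.rpow_neg_one] at this
        rw [this, ENNReal.ofReal_mul (by positivity)] }
  obtain ⟨c, hc⟩ := hinv.exists_eq_smul isConjInvariant_invariantVolume invariantVolume_ne_zero
  refine ⟨c, ?_⟩
  rw [← withDensity_smul_measure, ← hc, ← withDensity_mul _ (by fun_prop) (by fun_prop)]
  conv_lhs => rw [← withDensity_one (μ := μ)]
  refine withDensity_congr_ae (hpos.mono fun V hV => ?_)
  have hd := hV.det_pos
  rw [Pi.mul_apply, ← ENNReal.ofReal_mul (by positivity), ← Real.rpow_add hd, neg_add_cancel,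
    Real.rpow_zero, ENNReal.ofReal_one, Pi.one_apply]

theorem lintegral_wishartKernel (a : ℝ) :
    ∫⁻ V, ENNReal.ofReal (wishartKernel a V) ∂(invariantVolume M)
      = ENNReal.ofReal ((2 : ℝ) ^ (a * M / 2)) *
        ∫⁻ V, ENNReal.ofReal (V.det ^ (a / 2) * etr (-V)) ∂(invariantVolume M) := by
  have hm : Measurable fun V : Matrix (Fin M) (Fin M) ℝ =>
      ENNReal.ofReal (V.det ^ (a / 2) * etr (-V)) :=
    (Measurable.mul (by fun_prop) (measurable_etr.comp
      (by fun_prop : Continuous _).measurable)).ennreal_ofReal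
  -- the substitution `V = S W Sᵀ` with `S = √2 I`
  let S : Matrix (Fin M) (Fin M) ℝ := Real.sqrt 2 • 1
  have hSV : ∀ V : Matrix (Fin M) (Fin M) ℝ, S * V * Sᵀ = (2 : ℝ) • V := by
    intro V
    simp [S, smul_smul]
  have hS : S.det ≠ 0 := by simp [S]
  conv_lhs => rw [← isConjInvariant_invariantVolume.map_conj S hS]
  rw [lintegral_map (by fun_prop) (measurable_conj S), ← lintegral_const_mul _ hm]
  refine lintegral_congr_ae (ae_posDef_invariantVolume.mono fun V hV => ?_)
  have hd := hV.det_pos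
  dsimp only
  rw [hSV, wishartKernel, ← ENNReal.ofReal_mul (by positivity), det_smul, Fintype.card_fin,
    Real.mul_rpow (by positivity) hd.le, ← Real.rpow_natCast, ← Real.rpow_mul (by positivity),
    smul_smul, mul_assoc]
  have e1 : (M : ℝ) * (a / 2) = a * M / 2 := by ring
  have e2 : (-(1 / 2) * 2 : ℝ) • V = -V := by norm_num
  rw [e1, e2]

/-- The multivariate gamma function as an integral against the invariant measure. -/
theorem multiGamma_eq_toReal (a : ℝ) :
    multiGamma M a
      = (∫⁻ V, ENNReal.ofReal (V.det ^ a * etr (-V)) ∂(invariantVolume M)).toReal := by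
  have hm : Measurable fun V : Matrix (Fin M) (Fin M) ℝ => etr (-V) :=
    measurable_etr.comp (by fun_prop : Continuous _).measurable
  have hm1 : Measurable fun V : Matrix (Fin M) (Fin M) ℝ => V.det ^ a * etr (-V) :=
    (by fun_prop : Measurable _).mul hm
  have hm2 : Measurable fun V : Matrix (Fin M) (Fin M) ℝ =>
      V.det ^ (a - ((M : ℝ) + 1) / 2) * etr (-V) := (by fun_prop : Measurable _).mul hm
  have hnn : 0 ≤ᵐ[posDefVolume M] fun V => V.det ^ (a - ((M : ℝ) + 1) / 2) * etr (-V) :=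
    ae_posDef_posDefVolume.mono fun V hV =>
      mul_nonneg (Real.rpow_nonneg hV.det_pos.le _) (Real.exp_pos _).le
  rw [multiGamma, integral_eq_lintegral_of_nonneg_ae hnn hm2.aestronglyMeasurable,
    invariantVolume, lintegral_withDensity_eq_lintegral_mul _ (by fun_prop) hm1.ennreal_ofReal]
  congr 1
  refine lintegral_congr_ae (ae_posDef_posDefVolume.mono fun V hV => ?_)
  have hd := hV.det_pos
  dsimp only
  rw [Pi.mul_apply, ← ENNReal.ofReal_mul (by positivity), ← mul_assoc, ← Real.rpow_add hd]
  congr 3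
  ring

/-- The constant of proportionality in the density of the pivot is found from the total mass one;
the same computation shows that the gamma integral converges and is not zero. -/
theorem multiGamma_half_pos_and_pivotLaw_eq (h : M ≤ n) :
    0 < multiGamma M ((n : ℝ) / 2) ∧ pivotLaw M n
      = (invariantVolume M).withDensity fun V => ENNReal.ofReal
          (((2 : ℝ) ^ ((n : ℝ) * M / 2) * multiGamma M ((n : ℝ) / 2))⁻¹ * wishartKernel n V) := by
  obtain ⟨c, hc⟩ := exists_map_scatter_volume h
  have h1 : (1 : Matrix (Fin M) (Fin M) ℝ).PosDef := PosDef.one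
  set k : ℝ := 1 / Real.sqrt ((2 * Real.pi) ^ (M * n) * (1 : Matrix (Fin M) (Fin M) ℝ).det ^ n)
  have hlaw : pivotLaw M n = (c * ENNReal.ofReal k) •
      (invariantVolume M).withDensity fun V => ENNReal.ofReal (wishartKernel n V) := by
    rw [pivotLaw, sampleLaw_eq_withDensity h1]
    simp only [likelihood_eq_likelihoodOfScatter h1]
    rw [map_withDensity_comp (g := fun T => ENNReal.ofReal (likelihoodOfScatter n 1 T)) _
      measurable_scatter (by fun_prop), hc, withDensity_smul_measure,
      ← withDensity_mul _ (by fun_prop) (by fun_prop), mul_smul]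
    congr 1
    rw [← withDensity_smul _ (by fun_prop)]
    refine withDensity_congr_ae (ae_posDef_invariantVolume.mono fun V hV => ?_)
    have hd := hV.det_pos
    rw [Pi.mul_apply, Pi.smul_apply, smul_eq_mul, ← ENNReal.ofReal_mul (by positivity),
      ← ENNReal.ofReal_mul (by positivity), likelihoodOfScatter, wishartKernel, inv_one,
      Matrix.mul_one]
    congr 1
    ring
  set J := ∫⁻ V, ENNReal.ofReal (V.det ^ ((n : ℝ) / 2) * etr (-V)) ∂(invariantVolume M) with hJ
  have hmass : c * ENNReal.ofReal k * (ENNReal.ofReal ((2 : ℝ) ^ ((n : ℝ) * M / 2)) * J) = 1 := by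
    rw [← lintegral_wishartKernel, ← setLIntegral_univ, ← withDensity_apply _ MeasurableSet.univ,
      ← smul_eq_mul, ← Measure.smul_apply, ← hlaw, measure_univ]
  have hJ0 : J ≠ 0 := fun h0 => by simp [h0] at hmass
  have hp2 : 0 < (2 : ℝ) ^ ((n : ℝ) * M / 2) := by positivity
  have hJt : J ≠ ⊤ := fun ht => by
    rw [ht, ENNReal.mul_top (ENNReal.ofReal_pos.2 hp2).ne'] at hmass
    rcases eq_or_ne (c * ENNReal.ofReal k) 0 with h0 | h0
    · simp [h0] at hmass
    · simp [ENNReal.mul_top h0] at hmass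
  have hG : multiGamma M ((n : ℝ) / 2) = J.toReal := multiGamma_eq_toReal _
  have hGpos : 0 < multiGamma M ((n : ℝ) / 2) := hG ▸ ENNReal.toReal_pos hJ0 hJt
  refine ⟨hGpos, ?_⟩
  have hck : c * ENNReal.ofReal k
      = ENNReal.ofReal ((2 : ℝ) ^ ((n : ℝ) * M / 2) * multiGamma M ((n : ℝ) / 2))⁻¹ := by
    rw [ENNReal.ofReal_inv_of_pos (by positivity), ENNReal.ofReal_mul hp2.le, hG,
      ENNReal.ofReal_toReal hJt]
    exact ENNReal.eq_inv_of_mul_eq_one_left hmass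
  rw [hlaw, hck, ← withDensity_smul _ (by fun_prop)]
  congr 1
  ext1 V
  rw [Pi.smul_apply, smul_eq_mul, ← ENNReal.ofReal_mul (by positivity)]

theorem multiGamma_half_pos (h : M ≤ n) : 0 < multiGamma M ((n : ℝ) / 2) :=
  (multiGamma_half_pos_and_pivotLaw_eq h).1

/-- For `n ≥ M` the pivot has the Wishart law `W_M(I, n)`. -/
theorem pivotLaw_eq_withDensity (h : M ≤ n) :
    pivotLaw M n = (invariantVolume M).withDensity fun V => ENNReal.ofReal
      (((2 : ℝ) ^ ((n : ℝ) * M / 2) * multiGamma M ((n : ℝ) / 2))⁻¹ * wishartKernel n V) :=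
  (multiGamma_half_pos_and_pivotLaw_eq h).2

theorem ae_posDef_pivotLaw (h : M ≤ n) : ∀ᵐ U ∂(pivotLaw M n), U.PosDef := by
  rw [pivotLaw_eq_withDensity h]
  exact (withDensity_absolutelyContinuous _ _).ae_le ae_posDef_invariantVolume

/-! ### The inverse-Wishart distribution -/

/-- The density of the inverse-Wishart distribution with respect to the invariant measure. -/
def invWishartRelDensity (Ψ : Matrix (Fin M) (Fin M) ℝ) (ν : ℝ) (A : Matrix (Fin M) (Fin M) ℝ) :
    ℝ :=
  Ψ.det ^ (ν / 2) / ((2 : ℝ) ^ (ν * M / 2) * multiGamma M (ν / 2)) *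
    (A.det ^ (-(ν / 2)) * etr (-(1 / 2 : ℝ) • (Ψ * A⁻¹)))

theorem measurable_etr_mul_inv (Ψ : Matrix (Fin M) (Fin M) ℝ) :
    Measurable fun A : Matrix (Fin M) (Fin M) ℝ => etr (-(1 / 2 : ℝ) • (Ψ * A⁻¹)) :=
  measurable_etr.comp ((by fun_prop : Continuous fun B : Matrix (Fin M) (Fin M) ℝ =>
    -(1 / 2 : ℝ) • (Ψ * B)).measurable.comp measurable_matrix_inv)

@[fun_prop]
theorem measurable_invWishartRelDensity (Ψ : Matrix (Fin M) (Fin M) ℝ) (ν : ℝ) :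
    Measurable (invWishartRelDensity Ψ ν) := by
  unfold invWishartRelDensity
  exact ((by fun_prop : Measurable _).mul (measurable_etr_mul_inv Ψ)).const_mul _

@[fun_prop]
theorem measurable_invWishartDensity (Ψ : Matrix (Fin M) (Fin M) ℝ) (ν : ℝ) :
    Measurable (invWishartDensity Ψ ν) := by
  unfold invWishartDensity
  exact (by fun_prop : Measurable _).mul (measurable_etr_mul_inv Ψ)

theorem inverseWishart_eq_withDensity (Ψ : Matrix (Fin M) (Fin M) ℝ) (ν : ℝ) :
    inverseWishart Ψ ν = (invariantVolume M).withDensity fun A => ENNReal.ofReal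
      (invWishartRelDensity Ψ ν A) := by
  rw [inverseWishart, invariantVolume, ← withDensity_mul _ (by fun_prop) (by fun_prop)]
  refine withDensity_congr_ae (ae_posDef_posDefVolume.mono fun A hA => ?_)
  have hd := hA.det_pos
  dsimp only
  rw [Pi.mul_apply, ← ENNReal.ofReal_mul (by positivity), invWishartDensity, invWishartRelDensity]
  have : -((ν + M + 1) / 2) = -(((M : ℝ) + 1) / 2) + -(ν / 2) := by ring
  rw [this, Real.rpow_add hd]
  congr 1
  ring

theorem map_inv_pivotLaw (h : M ≤ n) :
    (pivotLaw M n).map (fun U => U⁻¹) = inverseWishart 1 n := by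
  rw [pivotLaw_eq_withDensity h, inverseWishart_eq_withDensity]
  have hcongr : ((invariantVolume M).withDensity fun V => ENNReal.ofReal
      (((2 : ℝ) ^ ((n : ℝ) * M / 2) * multiGamma M ((n : ℝ) / 2))⁻¹ * wishartKernel n V))
      = (invariantVolume M).withDensity fun V => ENNReal.ofReal (invWishartRelDensity 1 n V⁻¹) := by
    refine withDensity_congr_ae (ae_posDef_invariantVolume.mono fun V hV => ?_)
    have hd := hV.det_pos
    simp only [wishartKernel, invWishartRelDensity, det_one, Real.one_rpow, one_div, Matrix.one_mul]
    rw [nonsing_inv_nonsing_inv _ hd.ne'.isUnit, det_nonsing_inv, Ring.inverse_eq_inv,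
      Real.inv_rpow hd.le, Real.rpow_neg hd.le, inv_inv]
  rw [hcongr, map_withDensity_comp (g := fun A => ENNReal.ofReal (invWishartRelDensity 1 n A)) _
    measurable_matrix_inv (by fun_prop), map_inv_invariantVolume]

theorem map_conj_inverseWishart_one {R : Matrix (Fin M) (Fin M) ℝ} (hR : R.det ≠ 0) (ν : ℝ) :
    (inverseWishart 1 ν).map (fun A => R * A * Rᵀ) = inverseWishart (R * Rᵀ) ν := by
  rw [inverseWishart_eq_withDensity, inverseWishart_eq_withDensity]
  have hcongr : ((invariantVolume M).withDensity fun V =>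
        ENNReal.ofReal (invWishartRelDensity 1 ν V))
      = (invariantVolume M).withDensity fun V => ENNReal.ofReal
        (invWishartRelDensity (R * Rᵀ) ν (R * V * Rᵀ)) := by
    refine withDensity_congr_ae (ae_posDef_invariantVolume.mono fun V hV => ?_)
    have hd := hV.det_pos
    have hdR : (R * Rᵀ).det = R.det ^ 2 := by rw [det_mul, det_transpose, sq]
    have hdV : (R * V * Rᵀ).det = R.det ^ 2 * V.det := by
      rw [det_mul, det_mul, det_transpose]; ring
    have hR2 : 0 < R.det ^ 2 := by positivity
    have htr : (R * Rᵀ * (R * V * Rᵀ)⁻¹).trace = V⁻¹.trace := by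
      rw [Matrix.mul_inv_rev, Matrix.mul_inv_rev, ← Matrix.mul_assoc, Matrix.mul_assoc R,
        mul_nonsing_inv _ (by simpa using hR.isUnit), Matrix.mul_one, trace_mul_comm,
        Matrix.mul_assoc, nonsing_inv_mul _ hR.isUnit, Matrix.mul_one]
    simp only [invWishartRelDensity, etr, trace_smul, htr, hdR, hdV, det_one, Real.one_rpow,
      Matrix.one_mul]
    rw [Real.mul_rpow hR2.le hd.le, Real.rpow_neg hR2.le]
    congr 1
    have := (Real.rpow_pos_of_pos hR2 (ν / 2)).ne'
    field_simp
  rw [hcongr, map_withDensity_comp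
    (g := fun A => ENNReal.ofReal (invWishartRelDensity (R * Rᵀ) ν A)) _ (measurable_conj R)
    (by fun_prop),
    isConjInvariant_invariantVolume.map_conj R hR]

theorem ssmLaw_eq_inverseWishart (h : M ≤ n) {R : Matrix (Fin M) (Fin M) ℝ} (hR : R.det ≠ 0) :
    ssmLaw n R = inverseWishart (R * Rᵀ) n := by
  rw [← map_conj_inverseWishart_one hR, ← map_inv_pivotLaw h,
    Measure.map_map (measurable_conj R) measurable_matrix_inv]
  rfl

theorem isProbabilityMeasure_inverseWishart (h : M ≤ n) {Ψ : Matrix (Fin M) (Fin M) ℝ}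
    (hΨ : Ψ.PosDef) : IsProbabilityMeasure (inverseWishart Ψ n) := by
  obtain ⟨Q, hQ, rfl⟩ := exists_posDef_sq hΨ
  have hQt := hQ.transpose_eq
  have : ssmLaw n Q = inverseWishart (Q * Q) n := by
    rw [ssmLaw_eq_inverseWishart h hQ.det_pos.ne', hQt]
  rw [← this]
  exact Measure.isProbabilityMeasure_map
    ((measurable_conj Q).comp measurable_matrix_inv).aemeasurable

/-! ### Predictive densities -/

theorem scatter_appendObs (x : Fin n → EuclideanSpace ℝ (Fin M)) (y : EuclideanSpace ℝ (Fin M)) :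
    scatter (appendObs x y) = scatter x + vecMulVec y.ofLp y.ofLp := by
  simp [scatter, appendObs, Fin.sum_univ_castSucc]

theorem posDef_add_vecMulVec {Ψ : Matrix (Fin M) (Fin M) ℝ} (hΨ : Ψ.PosDef) (v : Fin M → ℝ) :
    (Ψ + vecMulVec v v).PosDef := by
  simpa using hΨ.add_posSemidef (posSemidef_vecMulVec_self_star v)

theorem le_of_posDef_scatter {x : Fin n → EuclideanSpace ℝ (Fin M)} (hx : (scatter x).PosDef) :
    M ≤ n := by
  have h1 := rank_of_isUnit _ hx.isUnit
  rw [scatter_eq_mul_transpose, Fintype.card_fin] at h1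
  have h2 := rank_mul_le_left (Matrix.of fun a i => x i a) (Matrix.of fun a i => x i a)ᵀ
  have h3 := rank_le_card_width (Matrix.of fun a i => x i a)
  rw [Fintype.card_fin] at h3
  omega

theorem invWishartDensity_nonneg {m : ℕ} (h : M ≤ m) {Ψ A : Matrix (Fin M) (Fin M) ℝ}
    (hΨ : Ψ.PosDef) (hA : A.PosDef) : 0 ≤ invWishartDensity Ψ m A := by
  have := hΨ.det_pos
  have := hA.det_pos
  have := multiGamma_half_pos h
  unfold invWishartDensity etr
  positivity

theorem lintegral_invWishartDensity {m : ℕ} (h : M ≤ m) {Ψ : Matrix (Fin M) (Fin M) ℝ}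
    (hΨ : Ψ.PosDef) :
    ∫⁻ A, ENNReal.ofReal (invWishartDensity Ψ m A) ∂(posDefVolume M) = 1 := by
  have := isProbabilityMeasure_inverseWishart h hΨ
  rw [← setLIntegral_univ, ← withDensity_apply _ MeasurableSet.univ]
  exact measure_univ (μ := inverseWishart Ψ m)

theorem integrable_invWishartDensity {m : ℕ} (h : M ≤ m) {Ψ : Matrix (Fin M) (Fin M) ℝ}
    (hΨ : Ψ.PosDef) : Integrable (invWishartDensity Ψ m) (posDefVolume M) := by
  refine ⟨(measurable_invWishartDensity Ψ m).aestronglyMeasurable, ?_⟩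
  rw [hasFiniteIntegral_iff_ofReal
    (ae_posDef_posDefVolume.mono fun A hA => invWishartDensity_nonneg h hΨ hA),
    lintegral_invWishartDensity h hΨ]
  exact ENNReal.one_lt_top

theorem integral_invWishartDensity {m : ℕ} (h : M ≤ m) {Ψ : Matrix (Fin M) (Fin M) ℝ}
    (hΨ : Ψ.PosDef) : ∫ A, invWishartDensity Ψ m A ∂(posDefVolume M) = 1 := by
  rw [integral_eq_lintegral_of_nonneg_ae
    (ae_posDef_posDefVolume.mono fun A hA => invWishartDensity_nonneg h hΨ hA)
    (measurable_invWishartDensity Ψ m).aestronglyMeasurable, lintegral_invWishartDensity h hΨ,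
    ENNReal.toReal_one]

/-- The predictive density of the inverse-Wishart distribution `W_M^{-1}(Ψ, m)`, with
`Ψ' = Ψ + y yᵀ`. -/
def predictiveFactor (m : ℕ) (Ψ Ψ' : Matrix (Fin M) (Fin M) ℝ) : ℝ :=
  1 / Real.pi ^ ((M : ℝ) / 2) * (Ψ.det ^ ((m : ℝ) / 2) / Ψ'.det ^ (((m : ℝ) + 1) / 2)) *
    (multiGamma M (((m : ℝ) + 1) / 2) / multiGamma M ((m : ℝ) / 2))

theorem sqrt_two_pi_pow_mul {d : ℝ} (hd : 0 ≤ d) (k : ℕ) :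
    Real.sqrt ((2 * Real.pi) ^ k * d)
      = (2 : ℝ) ^ ((k : ℝ) / 2) * Real.pi ^ ((k : ℝ) / 2) * d ^ (1 / 2 : ℝ) := by
  rw [Real.sqrt_eq_rpow, Real.mul_rpow (by positivity) hd, ← Real.rpow_natCast,
    ← Real.rpow_mul (by positivity), Real.mul_rpow (by positivity) (by positivity)]
  congr 3 <;> ring_nf

/-- Conjugacy: multiplying the inverse-Wishart density by the Gaussian density of a new
observation gives, up to a constant, the inverse-Wishart density with updated parameters. -/
theorem gaussDensity_mul_invWishartDensity {m : ℕ} (h : M ≤ m) {Ψ A : Matrix (Fin M) (Fin M) ℝ}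
    (hΨ : Ψ.PosDef) (hA : A.PosDef) (y : EuclideanSpace ℝ (Fin M)) :
    gaussDensity A y * invWishartDensity Ψ m A
      = predictiveFactor m Ψ (Ψ + vecMulVec y.ofLp y.ofLp) *
        invWishartDensity (Ψ + vecMulVec y.ofLp y.ofLp) ((m + 1 : ℕ) : ℝ) A := by
  set Ψ' := Ψ + vecMulVec y.ofLp y.ofLp with hΨ'
  have hd := hA.det_pos
  have hd' : 0 < Ψ'.det := (posDef_add_vecMulVec hΨ y.ofLp).det_pos
  have hG := multiGamma_half_pos h
  have hG' := multiGamma_half_pos (h.trans m.le_succ)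
  push_cast at hG' ⊢
  have e1 : (2 : ℝ) ^ (((m : ℝ) + 1) * M / 2)
      = (2 : ℝ) ^ ((m : ℝ) * M / 2) * 2 ^ ((M : ℝ) / 2) := by
    rw [← Real.rpow_add two_pos]; congr 1; ring
  have e2 : A.det ^ (-(((m : ℝ) + 1 + M + 1) / 2))
      = A.det ^ (-(((m : ℝ) + M + 1) / 2)) / A.det ^ (1 / 2 : ℝ) := by
    rw [← Real.rpow_sub hd]; congr 1; ring
  have e3 : etr (-(1 / 2 : ℝ) • (Ψ' * A⁻¹))
      = Real.exp (-(1 / 2) * (y.ofLp ⬝ᵥ (A⁻¹ *ᵥ y.ofLp))) * etr (-(1 / 2 : ℝ) • (Ψ * A⁻¹)) := by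
    rw [etr, etr, ← Real.exp_add, hΨ', Matrix.add_mul, trace_smul, trace_smul, trace_add,
      vecMulVec_mul, trace_vecMulVec, dotProduct_comm y.ofLp (_ ᵥ* _),
      ← dotProduct_mulVec]
    congr 1
    simp only [smul_eq_mul]
    ring
  have hq := Real.rpow_pos_of_pos hd' (((m : ℝ) + 1) / 2)
  have hh := Real.rpow_pos_of_pos hd (1 / 2)
  rw [gaussDensity, invWishartDensity, invWishartDensity, predictiveFactor, e1, e2, e3,
    sqrt_two_pi_pow_mul hd.le]
  field_simp

theorem predictiveDensity_inverseWishart {m : ℕ} (h : M ≤ m) {Ψ : Matrix (Fin M) (Fin M) ℝ}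
    (hΨ : Ψ.PosDef) (y : EuclideanSpace ℝ (Fin M)) :
    Integrable (fun A => gaussDensity A y) (inverseWishart Ψ m) ∧
      predictiveDensity (inverseWishart Ψ m) y
        = predictiveFactor m Ψ (Ψ + vecMulVec y.ofLp y.ofLp) := by
  have hΨ' := posDef_add_vecMulVec hΨ y.ofLp
  have hm : Measurable fun A => ENNReal.ofReal (invWishartDensity Ψ m A) := by fun_prop
  have hcongr : (fun A => (ENNReal.ofReal (invWishartDensity Ψ m A)).toReal • gaussDensity A y)
      =ᵐ[posDefVolume M] fun A => predictiveFactor m Ψ (Ψ + vecMulVec y.ofLp y.ofLp) *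
        invWishartDensity (Ψ + vecMulVec y.ofLp y.ofLp) ((m + 1 : ℕ) : ℝ) A := by
    filter_upwards [ae_posDef_posDefVolume] with A hA
    rw [ENNReal.toReal_ofReal (invWishartDensity_nonneg h hΨ hA), smul_eq_mul, mul_comm,
      gaussDensity_mul_invWishartDensity h hΨ hA]
  constructor
  · rw [inverseWishart, integrable_withDensity_iff_integrable_smul' hm
      (ae_of_all _ fun _ => ENNReal.ofReal_lt_top), integrable_congr hcongr]
    exact (integrable_invWishartDensity (h.trans m.le_succ) hΨ').const_mul _
  · rw [predictiveDensity, inverseWishart, integral_withDensity_eq_integral_toReal_smul hm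
      (ae_of_all _ fun _ => ENNReal.ofReal_lt_top), integral_congr_ae hcongr, integral_const_mul,
      integral_invWishartDensity (h.trans m.le_succ) hΨ', mul_one]

/-! ### The normalized likelihood method -/

/-- The normalizer `C(x^n)` for a sample of size `m + M + 1` with scatter matrix `Ψ`. -/
def nlmConstant (m : ℕ) (Ψ : Matrix (Fin M) (Fin M) ℝ) : ℝ :=
  multiGamma M ((m : ℝ) / 2) /
    ((2 : ℝ) ^ ((M : ℝ) * ((M : ℝ) + 1) / 2) * Real.pi ^ ((M : ℝ) * (m + M + 1) / 2) *
      Ψ.det ^ ((m : ℝ) / 2))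

theorem nlmConstant_pos {m : ℕ} (h : M ≤ m) {Ψ : Matrix (Fin M) (Fin M) ℝ} (hΨ : Ψ.PosDef) :
    0 < nlmConstant m Ψ := by
  have := hΨ.det_pos
  have := multiGamma_half_pos h
  unfold nlmConstant
  positivity

/-- As a function of `Σ`, the likelihood is a multiple of the inverse-Wishart density with
`n - M - 1` degrees of freedom. -/
theorem likelihood_eq_mul_invWishartDensity {m : ℕ} (h : M ≤ m) (hn : n = m + M + 1)
    {x : Fin n → EuclideanSpace ℝ (Fin M)} (hx : (scatter x).PosDef)
    {A : Matrix (Fin M) (Fin M) ℝ} (hA : A.PosDef) :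
    likelihood x A = nlmConstant m (scatter x) * invWishartDensity (scatter x) m A := by
  have hd := hA.det_pos
  have hdx := hx.det_pos
  have hG := multiGamma_half_pos h
  have hq := Real.rpow_pos_of_pos hdx ((m : ℝ) / 2)
  have e1 : (2 : ℝ) ^ ((M : ℝ) * (m + M + 1) / 2)
      = 2 ^ ((M : ℝ) * ((M : ℝ) + 1) / 2) * 2 ^ ((m : ℝ) * M / 2) := by
    rw [← Real.rpow_add two_pos]; congr 1; ring
  have e2 : (A.det ^ n) ^ (1 / 2 : ℝ) = (A.det ^ (-(((m : ℝ) + M + 1) / 2)))⁻¹ := by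
    rw [Real.rpow_neg hd.le, inv_inv, ← Real.rpow_natCast, ← Real.rpow_mul hd.le, hn]
    congr 1
    push_cast
    ring
  have hh := Real.rpow_pos_of_pos hd (-(((m : ℝ) + M + 1) / 2))
  have hMn : ((M * n : ℕ) : ℝ) = (M : ℝ) * (m + M + 1) := by rw [hn]; push_cast; ring
  rw [likelihood_eq_likelihoodOfScatter hA, likelihoodOfScatter, invWishartDensity, nlmConstant,
    sqrt_two_pi_pow_mul (pow_nonneg hd.le n), e2, hMn, e1]
  field_simp

theorem integrableOn_likelihood {m : ℕ} (h : M ≤ m) (hn : n = m + M + 1)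
    {x : Fin n → EuclideanSpace ℝ (Fin M)} (hx : (scatter x).PosDef) :
    IntegrableOn (likelihood x) (posDefSet M) (symVolume M) :=
  ((integrable_invWishartDensity h hx).const_mul (nlmConstant m (scatter x))).congr
    (ae_posDef_posDefVolume.mono fun _ hA =>
      (likelihood_eq_mul_invWishartDensity h hn hx hA).symm)

theorem nlmNormalizer_eq {m : ℕ} (h : M ≤ m) (hn : n = m + M + 1)
    {x : Fin n → EuclideanSpace ℝ (Fin M)} (hx : (scatter x).PosDef) :
    nlmNormalizer x = nlmConstant m (scatter x) := by
  rw [nlmNormalizer, integral_congr_ae (ae_posDef_posDefVolume.mono fun _ hA =>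
    likelihood_eq_mul_invWishartDensity h hn hx hA), integral_const_mul,
    integral_invWishartDensity h hx, mul_one]

theorem nlmLaw_eq_inverseWishart {m : ℕ} (h : M ≤ m) (hn : n = m + M + 1)
    {x : Fin n → EuclideanSpace ℝ (Fin M)} (hx : (scatter x).PosDef) :
    nlmLaw x = inverseWishart (scatter x) m := by
  refine withDensity_congr_ae (ae_posDef_posDefVolume.mono fun A hA => ?_)
  dsimp only
  rw [nlmNormalizer_eq h hn hx, likelihood_eq_mul_invWishartDensity h hn hx hA,
    mul_div_cancel_left₀ _ (nlmConstant_pos h hx).ne']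

theorem nlmConstant_div {m : ℕ} (h : M ≤ m) {Ψ Ψ' : Matrix (Fin M) (Fin M) ℝ} (hΨ : Ψ.PosDef)
    (hΨ' : Ψ'.PosDef) : nlmConstant (m + 1) Ψ' / nlmConstant m Ψ = predictiveFactor m Ψ Ψ' := by
  have hG := multiGamma_half_pos h
  have hG' := multiGamma_half_pos (h.trans m.le_succ)
  have hd := Real.rpow_pos_of_pos hΨ.det_pos ((m : ℝ) / 2)
  have hd' := Real.rpow_pos_of_pos hΨ'.det_pos (((m : ℝ) + 1) / 2)
  unfold nlmConstant predictiveFactor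
  push_cast at hG' ⊢
  have e : Real.pi ^ ((M : ℝ) * (m + 1 + M + 1) / 2)
      = Real.pi ^ ((M : ℝ) * (m + M + 1) / 2) * Real.pi ^ ((M : ℝ) / 2) := by
    rw [← Real.rpow_add Real.pi_pos]; congr 1; ring
  rw [e]
  field_simp

end

theorem mainTheorem8 (M n : ℕ) :
    -- the model: the law of the sample has density `f(x^n | Σ)`
    (∀ A : Matrix (Fin M) (Fin M) ℝ, A.PosDef →
      sampleLaw n A
          = (volume : Measure (Fin n → EuclideanSpace ℝ (Fin M))).withDensity
              (fun x => ENNReal.ofReal (likelihood x A)) ∧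
      ∀ x : Fin n → EuclideanSpace ℝ (Fin M),
        likelihood x A
          = 1 / Real.sqrt ((2 * Real.pi) ^ (M * n) * A.det ^ n)
              * etr (-(1 / 2 : ℝ) • (scatter x * A⁻¹))) ∧
    -- `Σ̂_n` is a sufficient statistic for `Σ`
    IsSufficientStatistic
      (fun A : {A : Matrix (Fin M) (Fin M) ℝ // A.PosDef} => sampleLaw n A.1) scatter ∧
    -- the pivotal equation `Σ̂_n = S U Sᵀ` and its solution `Σ = Ŝ U⁻¹ Ŝᵀ`, `Ŝ = S U^{1/2}`
    (∀ A S : Matrix (Fin M) (Fin M) ℝ, A.PosDef → S * Sᵀ = A →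
      (sampleLaw n (1 : Matrix (Fin M) (Fin M) ℝ)).map
          (fun z i => WithLp.toLp 2 (S *ᵥ (z i).ofLp)) = sampleLaw n A ∧
      ∀ z : Fin n → EuclideanSpace ℝ (Fin M),
        scatter (fun i => WithLp.toLp 2 (S *ᵥ (z i).ofLp)) = S * scatter z * Sᵀ ∧
        ((scatter z).PosDef →
          ∃ Q : Matrix (Fin M) (Fin M) ℝ, Q.PosDef ∧ Q * Q = scatter z ∧
            (S * Q) * (S * Q)ᵀ = S * scatter z * Sᵀ ∧
            A = pivotSolution (S * Q) (scatter z))) ∧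
    -- for `n ≥ M`: `U > 0` almost surely, and `U⁻¹` has law `W_M^{-1}(I, n)`
    (M ≤ n →
      (∀ᵐ U ∂(pivotLaw M n), U.PosDef) ∧
      (pivotLaw M n).map (fun U => U⁻¹) = inverseWishart 1 n) ∧
    -- the two methods, for observed data with nonsingular `Σ̂_n`
    (∀ x : Fin n → EuclideanSpace ℝ (Fin M), (scatter x).PosDef →
      -- sufficient statistic method: `Σ ∼ W_M^{-1}(Σ̂_n, n)`, and the predictive density
      (IsProbabilityMeasure (inverseWishart (scatter x) n) ∧
        ∀ R : Matrix (Fin M) (Fin M) ℝ, R * Rᵀ = scatter x →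
          ssmLaw n R = inverseWishart (scatter x) n ∧
          ∀ y : EuclideanSpace ℝ (Fin M),
            Integrable (fun A => gaussDensity A y) (ssmLaw n R) ∧
            predictiveDensity (ssmLaw n R) y
              = 1 / Real.pi ^ ((M : ℝ) / 2)
                * ((scatter x).det ^ ((n : ℝ) / 2)
                    / (scatter (appendObs x y)).det ^ (((n : ℝ) + 1) / 2))
                * (multiGamma M (((n : ℝ) + 1) / 2) / multiGamma M ((n : ℝ) / 2))) ∧
      -- normalized likelihood method, for `n > 2M` (where `C(x^n)` is finite)
      (2 * M < n →
        IntegrableOn (likelihood x) (posDefSet M) (symVolume M) ∧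
        nlmNormalizer x
          = multiGamma M ((n : ℝ) / 2 - ((M : ℝ) + 1) / 2)
              / ((2 : ℝ) ^ ((M : ℝ) * ((M : ℝ) + 1) / 2) * Real.pi ^ ((M : ℝ) * n / 2)
                * (scatter x).det ^ ((n : ℝ) / 2 - ((M : ℝ) + 1) / 2)) ∧
        IsProbabilityMeasure (nlmLaw x) ∧
        ∀ y : EuclideanSpace ℝ (Fin M),
          Integrable (fun A => gaussDensity A y) (nlmLaw x) ∧
          predictiveDensity (nlmLaw x) y = nlmNormalizer (appendObs x y) / nlmNormalizer x ∧
          predictiveDensity (nlmLaw x) y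
            = 1 / Real.pi ^ ((M : ℝ) / 2)
              * ((scatter x).det ^ ((n : ℝ) / 2 - ((M : ℝ) + 1) / 2)
                  / (scatter (appendObs x y)).det ^ ((n : ℝ) / 2 - (M : ℝ) / 2))
              * (multiGamma M ((n : ℝ) / 2 - (M : ℝ) / 2)
                  / multiGamma M ((n : ℝ) / 2 - ((M : ℝ) + 1) / 2)))) := by
  refine ⟨fun A hA => ⟨sampleLaw_eq_withDensity hA, likelihood_eq_likelihoodOfScatter hA⟩,
    isSufficientStatistic_scatter, fun A S hA hS => ⟨map_sampleLaw_one hA hS, fun z =>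
      ⟨scatter_mulVec S z, fun hz => ?_⟩⟩,
    fun h => ⟨ae_posDef_pivotLaw h, map_inv_pivotLaw h⟩, fun x hx => ⟨?_, fun hMn => ?_⟩⟩
  · obtain ⟨Q, hQ, hQz⟩ := exists_posDef_sq hz
    have hQt := hQ.transpose_eq
    have hQu : IsUnit Q.det := hQ.det_pos.ne'.isUnit
    refine ⟨Q, hQ, hQz, ?_, ?_⟩
    · rw [← hQz, Matrix.transpose_mul, hQt]
      simp only [Matrix.mul_assoc]
    · have : Q * (scatter z)⁻¹ * Q = 1 := by
        rw [← hQz, Matrix.mul_inv_rev, ← Matrix.mul_assoc, mul_nonsing_inv _ hQu, Matrix.one_mul,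
          nonsing_inv_mul _ hQu]
      rw [pivotSolution, Matrix.transpose_mul, hQt, ← hS]
      calc S * Sᵀ = S * (Q * (scatter z)⁻¹ * Q) * Sᵀ := by rw [this, Matrix.mul_one]
        _ = S * Q * (scatter z)⁻¹ * (Q * Sᵀ) := by simp only [Matrix.mul_assoc]
  · have h := le_of_posDef_scatter hx
    refine ⟨isProbabilityMeasure_inverseWishart h hx, fun R hR => ?_⟩
    have hlaw : ssmLaw n R = inverseWishart (scatter x) n := by
      rw [ssmLaw_eq_inverseWishart h (det_ne_zero_of_mul_transpose_posDef hx hR), hR]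
    refine ⟨hlaw, fun y => ?_⟩
    rw [hlaw, scatter_appendObs]
    exact predictiveDensity_inverseWishart h hx y
  · obtain ⟨m, hm⟩ : ∃ m, n = m + M + 1 := ⟨n - M - 1, by omega⟩
    -- the degrees of freedom `m = n - M - 1` of the inverse-Wishart law; `n > 2M` gives `M ≤ m`
    have h : M ≤ m := by omega
    have e1 : (n : ℝ) / 2 - ((M : ℝ) + 1) / 2 = (m : ℝ) / 2 := by rw [hm]; push_cast; ring
    have e2 : (n : ℝ) / 2 - (M : ℝ) / 2 = ((m : ℝ) + 1) / 2 := by rw [hm]; push_cast; ring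
    have e3 : (n : ℝ) = m + M + 1 := by rw [hm]; push_cast; ring
    have hlaw := nlmLaw_eq_inverseWishart h hm hx
    rw [e1, e2, hlaw]
    refine ⟨integrableOn_likelihood h hm hx, ?_, isProbabilityMeasure_inverseWishart h hx,
      fun y => ?_⟩
    · rw [nlmNormalizer_eq h hm hx, nlmConstant, e3]
    · obtain ⟨hint, hpred⟩ := predictiveDensity_inverseWishart h hx y
      have hy : (scatter (appendObs x y)).PosDef := by
        rw [scatter_appendObs]; exact posDef_add_vecMulVec hx _
      refine ⟨hint, ?_, ?_⟩
      · rw [nlmNormalizer_eq h hm hx, nlmNormalizer_eq (m := m + 1) (by omega) (by omega) hy,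
          nlmConstant_div h hx hy, hpred, scatter_appendObs]
      · rw [hpred, scatter_appendObs, predictiveFactor]
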